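/- \textbf{Theorem (tightness at rate $1/\sqrt n$ in multiscale norm).} Notation. Let $\psi=-1_{(0,1/2]}+1_{(1/2,1]}$, $\psi_{lk}(x)=2^{l/2}\psi(2^lx-k)$ for $l\ge 0$, $0\le k<2^l$, be the Haar wavelets on $[0,1]$, and $g_{lk}=\int_0^1 g\psi_{lk}$. For $\alpha\in(0,1]$ and $R,m_0,m_1>0$ put $$\mathcal H(\alpha,R)=\{f:\ |f_{lk}|\le R2^{-l(\alpha+1/2)}\ \text{ for all } l\ge0,\ 0\le k<2^l\},\qquad \mathcal F(m_0,m_1)=\Big\{f:\ \int_0^1 f=1,\ m_0\le f\le m_1\Big\}.$$ For a sequence $\bar w=(\bar w_l)_{l\ge0}$ of positive numbers let $\|g\|_{\mathcal M_0(\bar w)}=\sup_{l\ge0}\max_{0\le k<2^l}|g_{lk}|/\bar w_l$. Prior. Given $n\ge1$, let $L=L(n)$ be the largest integer with $2^LL^2\le n$. Let $a\ge1$ be an integer, $\kappa>0$, and $l_0(n)$ a nonnegative integer. For each finite binary word $\varepsilon$ of length $|\varepsilon|<L$ let $Y_{\varepsilon0}$ be independent random variables, with $$Y_{\varepsilon0}\sim\mathrm{Beta}(a,a)\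 \text{ if } |\varepsilon|\le l_0(n),\qquad Y_{\varepsilon0}\sim(1-\pi_{\varepsilon0})\delta_{1/2}+\pi_{\varepsilon0}\,\mathrm{Beta}(a,a)\ \text{ if } l_0(n)<|\varepsilon|<L,\qquad \pi_{\varepsilon0}=e^{-\kappa|\varepsilon0|}=e^{-\kappa(|\varepsilon|+1)},$$ and set $Y_{\varepsilon1}=1-Y_{\varepsilon0}$. For a word $\varepsilon=\varepsilon_1\cdots\varepsilon_L$ that is the binary expansion of $k2^{-L}$, let $I_\varepsilon=(k2^{-L},(k+1)2^{-L}]$ and $P(I_\varepsilon)=\prod_{j=1}^LY_{\varepsilon_1\cdots\varepsilon_j}$. The prior $\Pi$ is the law of the random histogram density $f$ on $(0,1]$ that equals $2^LP(I_\varepsilon)$ on each $I_\varepsilon$, $|\varepsilon|=L$. Given $f$, the data $X=(X_1,\dots,X_n)$ are i.i.d. with density $f$, and $\Pi(\cdot\,|\,X)$ is the posterior distribution, i.e. the conditional distribution of $f$ given $X$. $E_{f_0}$ denotes expectation when $X_1,\dots,X_n$ are i.i.d. with density $f_0$. Statement. For all $m_0,m_1>0$ there is $\kappa_0=\kappa_0(m_0,m_1)>0$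 such that the following holds for every $\kappa\ge\kappa_0$ and every integer $a\ge1$. Let $(l_0(n))_n$ be a nondecreasing sequence of nonnegative integers with $l_0(n)\to\infty$ and $l_0(n)=o(\log n)$. Let $(\bar w_l)_{l\ge0}$ be a sequence of positive numbers such that, for some constant $c>0$, $\bar w_l\ge c\sqrt l$ for all $l\ge 0$ and, for all large enough $n$, $\bar w_l\ge c\sqrt{\log n}$ for all $l\ge l_0(n)$ (if $\bar w$ is nondecreasing, the latter just says $\bar w_{l_0(n)}\ge c\sqrt{\log n}$). Then for every $\eta>0$, $R>0$ and $\alpha\in(0,1]$ there exist $M>0$ and $n_0\ge1$ such that for every $n\ge n_0$ $$\sup_{f_0\in\mathcal H(\alpha,R)\cap\mathcal F(m_0,m_1)}E_{f_0}\Big[\Pi\big(\|f-f_0\|_{\mathcal M_0(\bar w)}\ge M/\sqrt n\,\big|\,X\big)\Big]<\eta.$$ -/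

import Mathlib

open MeasureTheory ProbabilityTheory Filter Set
open scoped ENNReal unitInterval

noncomputable section

namespace SpikeSlabPolyaTree

/-! ### Haar basis, function classes, multiscale norm -/

/-- The mother Haar wavelet `ψ = -1_{(0,1/2]} + 1_{(1/2,1]}`. -/
def haarMother (x : ℝ) : ℝ :=
  (Ioc (1 / 2 : ℝ) 1).indicator (fun _ => (1 : ℝ)) x
    - (Ioc (0 : ℝ) (1 / 2)).indicator (fun _ => (1 : ℝ)) x

/-- The Haar wavelet `ψ_{lk}(x) = 2^{l/2} ψ(2^l x - k)`. -/
def haar (l k : ℕ) (x : ℝ) : ℝ :=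
  (2 : ℝ) ^ ((l : ℝ) / 2) * haarMother ((2 : ℝ) ^ l * x - k)

/-- The Haar coefficient `g_{lk} = ⟨g, ψ_{lk}⟩ = ∫_0^1 g ψ_{lk}`. -/
def haarCoeff (g : ℝ → ℝ) (l k : ℕ) : ℝ :=
  ∫ x in Icc (0 : ℝ) 1, g x * haar l k x

/-- The Hölder-type ball `H(α, R)`, described through Haar coefficients. -/
def holderBall (α R : ℝ) : Set (ℝ → ℝ) :=
  {f | ∀ l k : ℕ, k < 2 ^ l → |haarCoeff f l k| ≤ R * (2 : ℝ) ^ (-(l : ℝ) * (α + 1 / 2))}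

/-- The class `F(m₀, m₁)` of probability densities on `[0,1]` with `m₀ ≤ f ≤ m₁` (almost
everywhere). Only the values of `f` on `[0,1]` matter. -/
def densityClass (m₀ m₁ : ℝ) : Set (ℝ → ℝ) :=
  {f | IntegrableOn f (Icc 0 1) ∧ ∫ x in Icc (0 : ℝ) 1, f x = 1 ∧
    ∀ᵐ x ∂(volume.restrict (Icc (0 : ℝ) 1)), m₀ ≤ f x ∧ f x ≤ m₁}

/-- The multiscale norm `‖g‖_{M₀(w)} = sup_l max_{0 ≤ k < 2^l} |g_{lk}| / w_l`, with values in
`[0, ∞]`. -/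
def multiscaleNorm (w : ℕ → ℝ) (g : ℝ → ℝ) : ℝ≥0∞ :=
  ⨆ (l : ℕ) (k : Fin (2 ^ l)), ENNReal.ofReal (|haarCoeff g l k| / w l)

/-! ### Sampling model -/

/-- The measure `P_f` on `[0,1]` with Lebesgue density `f`. -/
def densityMeasure (f : ℝ → ℝ) : Measure ℝ :=
  (volume.restrict (Icc (0 : ℝ) 1)).withDensity fun x => ENNReal.ofReal (f x)

/-- The law `P_f^{⊗ n}` of an i.i.d. sample of size `n`. -/
def sampleLaw (n : ℕ) (f : ℝ → ℝ) : Measure (Fin n → ℝ) :=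
  Measure.pi fun _ => densityMeasure f

/-! ### Tree-type densities -/

/-- Dyadic tree masses. The node `(l, k)`, `k < 2^l`, stands for the interval
`(k/2^l, (k+1)/2^l]`; its left and right children are `(l+1, 2k)` and `(l+1, 2k+1)`, and `Y l k`
is the proportion of the mass of the node that goes to the left child. -/
def treeMass (Y : ℕ → ℕ → ℝ) : ℕ → ℕ → ℝ
  | 0, _ => 1
  | l + 1, k => treeMass Y l (k / 2) * (if k % 2 = 0 then Y l (k / 2) else 1 - Y l (k / 2))

/-- The internal nodes of the binary tree truncated at depth `L`: pairs `(l, k)` with `l < L` and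
`k < 2^l`. -/
abbrev Node (L : ℕ) : Type := Σ l : Fin L, Fin (2 ^ (l : ℕ))

/-- A collection of splitting variables, one for each internal node. -/
abbrev Splits (L : ℕ) : Type := Node L → I

/-- The splitting variables as a doubly indexed family, with even splits outside the tree. -/
def splitAt {L : ℕ} (Y : Splits L) (l k : ℕ) : ℝ :=
  if h : l < L ∧ k < 2 ^ l then (Y ⟨⟨l, h.1⟩, ⟨k, h.2⟩⟩ : ℝ) else 1 / 2

/-- The histogram density on the dyadic intervals of length `2^{-L}` whose masses are given by the
splitting variables `Y`. -/
def treeDensity (L : ℕ) (Y : Splits L) (x : ℝ) : ℝ :=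
  ∑ k ∈ Finset.range (2 ^ L),
    (Ioc ((k : ℝ) / 2 ^ L) (((k : ℝ) + 1) / 2 ^ L)).indicator
      (fun _ => (2 : ℝ) ^ L * treeMass (splitAt Y) L k) x

/-! ### Spike and slab Pólya tree prior with flat initialisation -/

/-- The cut-off: the largest integer `L` with `2^L L^2 ≤ n`. -/
def cutoff (n : ℕ) : ℕ := Nat.findGreatest (fun L => 2 ^ L * L ^ 2 ≤ n) n

/-- The law `(1 - p) δ_{1/2} + p Beta(a, a)` on `[0,1]`. -/
def splitLaw (a : ℕ+) (p : ℝ) : Measure I :=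
  ENNReal.ofReal (1 - p) • Measure.dirac (⟨1 / 2, by norm_num, by norm_num⟩ : I)
    + ENNReal.ofReal p • (betaMeasure (a : ℕ) (a : ℕ)).comap Subtype.val

/-- The slab weight of the splitting variable of a node at depth `l`: it is `1` for `l ≤ l₀`, and
otherwise `e^{-κ (l+1)}`, the variable being attached to the left child, at depth `l + 1`. -/
def slabWeight (κ : ℝ) (l₀ l : ℕ) : ℝ :=
  if l ≤ l₀ then 1 else Real.exp (-κ * ((l : ℝ) + 1))

/-- The prior: independent splitting variables, pure `Beta(a, a)` up to depth `l₀`, spike and slab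
for `l₀ < l < L`. It is a prior on densities through `treeDensity L`. -/
def prior (a : ℕ+) (κ : ℝ) (l₀ L : ℕ) : Measure (Splits L) :=
  Measure.pi fun ν => splitLaw a (slabWeight κ l₀ (ν.1 : ℕ))

/-! ### Facts needed to form the posterior -/

instance isFiniteMeasure_splitLaw (a : ℕ+) (p : ℝ) : IsFiniteMeasure (splitLaw a p) := by
  have ha : (0 : ℝ) < ((a : ℕ) : ℝ) := by exact_mod_cast a.pos
  have := isProbabilityMeasureBeta ha ha
  constructor
  rw [splitLaw, Measure.add_apply, Measure.smul_apply, Measure.smul_apply,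
    (MeasurableEmbedding.subtype_coe measurableSet_Icc).comap_apply]
  refine ENNReal.add_lt_top.2 ⟨?_, ?_⟩
  · exact ENNReal.mul_lt_top ENNReal.ofReal_lt_top (measure_lt_top _ _)
  · exact ENNReal.mul_lt_top ENNReal.ofReal_lt_top (measure_lt_top _ _)

instance isFiniteMeasure_prior (a : ℕ+) (κ : ℝ) (l₀ L : ℕ) :
    IsFiniteMeasure (prior a κ l₀ L) := by
  unfold prior; infer_instance

lemma splitAt_mem {L : ℕ} (Y : Splits L) (l k : ℕ) : 0 ≤ splitAt Y l k ∧ splitAt Y l k ≤ 1 := by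
  unfold splitAt
  split_ifs with h
  · exact (Y _).2
  · norm_num

lemma treeMass_nonneg {L : ℕ} (Y : Splits L) (l k : ℕ) : 0 ≤ treeMass (splitAt Y) l k := by
  induction l generalizing k with
  | zero => simp [treeMass]
  | succ l ih =>
    rw [treeMass]
    refine mul_nonneg (ih _) ?_
    split_ifs
    · exact (splitAt_mem Y _ _).1
    · linarith [(splitAt_mem Y l (k / 2)).2]

lemma sum_treeMass (Y : ℕ → ℕ → ℝ) (l : ℕ) :
    ∑ k ∈ Finset.range (2 ^ l), treeMass Y l k = 1 := by
  have key : ∀ (g : ℕ → ℝ) (N : ℕ),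
      ∑ k ∈ Finset.range (N * 2), g k = ∑ k ∈ Finset.range N, (g (2 * k) + g (2 * k + 1)) := by
    intro g N
    induction N with
    | zero => simp
    | succ N ih =>
      rw [Nat.succ_mul, Finset.sum_range_succ, Finset.sum_range_succ, ih,
        Finset.sum_range_succ _ N, mul_comm N 2]
      ring
  induction l with
  | zero => simp [treeMass]
  | succ l ih =>
    rw [pow_succ, key, ← ih]
    refine Finset.sum_congr rfl fun k _ => ?_
    have h1 : (2 * k) / 2 = k := by omega
    have h2 : (2 * k + 1) / 2 = k := by omega
    have h3 : (2 * k) % 2 = 0 := by omega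
    have h4 : (2 * k + 1) % 2 ≠ 0 := by omega
    rw [treeMass, treeMass, h1, h2, if_pos h3, if_neg h4]
    ring

lemma measurable_splitAt {L : ℕ} (l k : ℕ) : Measurable fun Y : Splits L => splitAt Y l k := by
  unfold splitAt
  by_cases h : l < L ∧ k < 2 ^ l
  · simp only [h, and_self, dite_true]
    exact measurable_subtype_coe.comp (measurable_pi_apply _)
  · simp only [h, dite_false]
    exact measurable_const

lemma measurable_treeMass {L : ℕ} (l k : ℕ) :
    Measurable fun Y : Splits L => treeMass (splitAt Y) l k := by
  induction l generalizing k with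
  | zero => simp only [treeMass]; exact measurable_const
  | succ l ih =>
    simp only [treeMass]
    refine (ih _).mul ?_
    split_ifs
    · exact measurable_splitAt _ _
    · exact measurable_const.sub (measurable_splitAt _ _)

lemma measurable_treeDensity (L : ℕ) :
    Measurable fun p : Splits L × ℝ => treeDensity L p.1 p.2 := by
  unfold treeDensity
  refine Finset.measurable_sum _ fun k _ => ?_
  have : (fun p : Splits L × ℝ => (Ioc ((k : ℝ) / 2 ^ L) (((k : ℝ) + 1) / 2 ^ L)).indicator
      (fun _ => (2 : ℝ) ^ L * treeMass (splitAt p.1) L k) p.2)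
      = (Prod.snd ⁻¹' Ioc ((k : ℝ) / 2 ^ L) (((k : ℝ) + 1) / 2 ^ L)).indicator
        (fun p : Splits L × ℝ => (2 : ℝ) ^ L * treeMass (splitAt p.1) L k) := by
    ext p; simp [indicator]
  rw [this]
  exact (measurable_const.mul ((measurable_treeMass L k).comp measurable_fst)).indicator
    (measurable_snd measurableSet_Ioc)

lemma isProbabilityMeasure_tree (L : ℕ) (Y : Splits L) :
    IsProbabilityMeasure (densityMeasure (treeDensity L Y)) := by
  have hpos : (0 : ℝ) < 2 ^ L := by positivity
  constructor
  rw [densityMeasure, withDensity_apply _ MeasurableSet.univ, Measure.restrict_univ]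
  have h0 : ∀ x : ℝ, ∀ k ∈ Finset.range (2 ^ L),
      0 ≤ (Ioc ((k : ℝ) / 2 ^ L) (((k : ℝ) + 1) / 2 ^ L)).indicator
        (fun _ => (2 : ℝ) ^ L * treeMass (splitAt Y) L k) x := fun x k _ =>
    indicator_nonneg (fun _ _ => mul_nonneg hpos.le (treeMass_nonneg Y L k)) x
  simp only [treeDensity]
  simp_rw [fun x => ENNReal.ofReal_sum_of_nonneg (h0 x)]
  rw [lintegral_finsetSum]
  · calc
      _ = ∑ k ∈ Finset.range (2 ^ L), ENNReal.ofReal (treeMass (splitAt Y) L k) := by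
        refine Finset.sum_congr rfl fun k hk => ?_
        have hk' : (k : ℝ) + 1 ≤ 2 ^ L := by exact_mod_cast Finset.mem_range.1 hk
        have hind : ∀ x : ℝ, ENNReal.ofReal
            ((Ioc ((k : ℝ) / 2 ^ L) (((k : ℝ) + 1) / 2 ^ L)).indicator
              (fun _ => (2 : ℝ) ^ L * treeMass (splitAt Y) L k) x)
            = (Ioc ((k : ℝ) / 2 ^ L) (((k : ℝ) + 1) / 2 ^ L)).indicator
              (fun _ => ENNReal.ofReal ((2 : ℝ) ^ L * treeMass (splitAt Y) L k)) x := by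
          intro x; simp only [indicator]; split_ifs <;> simp
        have hsub : Ioc ((k : ℝ) / 2 ^ L) (((k : ℝ) + 1) / 2 ^ L) ⊆ Icc 0 1 := by
          intro x hx
          refine ⟨le_trans (by positivity) hx.1.le, hx.2.trans ?_⟩
          rw [div_le_one hpos]; exact hk'
        simp_rw [hind]
        rw [lintegral_indicator_const measurableSet_Ioc,
          Measure.restrict_apply measurableSet_Ioc, inter_eq_left.2 hsub, Real.volume_Ioc,
          ← ENNReal.ofReal_mul (mul_nonneg hpos.le (treeMass_nonneg Y L k))]
        congr 1
        field_simp
        ring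
      _ = 1 := by
        rw [← ENNReal.ofReal_sum_of_nonneg fun k _ => treeMass_nonneg Y L k, sum_treeMass,
          ENNReal.ofReal_one]
  · intro k _
    exact (measurable_const.indicator measurableSet_Ioc).ennreal_ofReal

lemma measurable_densityMeasure_tree (L : ℕ) :
    Measurable fun Y : Splits L => densityMeasure (treeDensity L Y) := by
  refine Measure.measurable_of_measurable_coe _ fun s hs => ?_
  simp only [densityMeasure, withDensity_apply _ hs]
  exact (measurable_treeDensity L).ennreal_ofReal.lintegral_prod_right'

lemma isProbabilityMeasure_sampleLaw_tree (L n : ℕ) (Y : Splits L) :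
    IsProbabilityMeasure (sampleLaw n (treeDensity L Y)) := by
  have := isProbabilityMeasure_tree L Y
  unfold sampleLaw; infer_instance

lemma measurable_sampleLaw_tree (L n : ℕ) :
    Measurable fun Y : Splits L => sampleLaw n (treeDensity L Y) := by
  have := isProbabilityMeasure_sampleLaw_tree L n
  have := isProbabilityMeasure_tree L
  refine Measurable.measure_of_isPiSystem_of_isProbabilityMeasure generateFrom_pi.symm
    isPiSystem_pi ?_
  rintro _ ⟨s, hs, rfl⟩
  simp only [sampleLaw, Measure.pi_pi]
  refine Finset.measurable_prod _ fun i _ => ?_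
  have hi : MeasurableSet (s i) := hs i (mem_univ i)
  exact (Measure.measurable_coe hi).comp (measurable_densityMeasure_tree L)

/-! ### Bayesian model and posterior -/

/-- The statistical model: given the splitting variables `Y`, the observations are i.i.d. with
density `treeDensity L Y`. -/
def model (L n : ℕ) : Kernel (Splits L) (Fin n → ℝ) where
  toFun Y := sampleLaw n (treeDensity L Y)
  measurable' := measurable_sampleLaw_tree L n

instance isMarkovKernel_model (L n : ℕ) : IsMarkovKernel (model L n) :=
  ⟨fun Y => isProbabilityMeasure_sampleLaw_tree L n Y⟩

/-- The posterior given the sample of size `n`, for the prior truncated at depth `cutoff n`: the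
conditional law of the splitting variables given the observations. -/
def posteriorLaw (a : ℕ+) (κ : ℝ) (l₀ n : ℕ) : Kernel (Fin n → ℝ) (Splits (cutoff n)) :=
  ProbabilityTheory.posterior (model (cutoff n) n) (prior a κ l₀ (cutoff n))

/-- The posterior probability `Π(‖f - f₀‖_{M₀(w)} ≥ r | X)`, where `f` is the density drawn from
the posterior. -/
def posteriorDeviation (a : ℕ+) (κ : ℝ) (l₀ n : ℕ) (w : ℕ → ℝ) (f₀ : ℝ → ℝ) (r : ℝ)
    (X : Fin n → ℝ) : ℝ≥0∞ :=
  posteriorLaw a κ l₀ n X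
    {Y | ENNReal.ofReal r ≤ multiscaleNorm w fun x => treeDensity (cutoff n) Y x - f₀ x}

end SpikeSlabPolyaTree

end

noncomputable section

namespace SpikeSlabPolyaTree

/-! ### Product measures and Bayes' formula -/

section Generic

/-! The likelihood of a tree density is a product over nodes: a node contributes y^N₀ (1-y)^N₁,
where N₀ and N₁ count the observations in its two children. The prior is a product as well, so under
the posterior each splitting variable can be studied alone (`posterior_split_le`).

At a node with N observations and empirical split z, the likelihood is at most exp(-N(y-z)²/2) times
its maximum, while the slab alone gives evidence of order N^(-1/2) times that maximum. So the
posterior mass at distance at least s from z is at most C exp(-Ns²/4) (1 + (1-p)/p √N), see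
`exists_setLIntegral_splitLaw_le`. No model selection argument is needed: a spike far from z is
penalised by the likelihood like any other point, and a spike close to z does no harm. Beyond depth
l₀ the price (1-p)/p √n is at most a power of n, because the tree has depth O(log n), and a radius
of order √(2^l log n / n) pays for it. Up to depth l₀ there is no spike, and √(2^l (l+1)/n) suffices
to beat the 2^l nodes of a level. Chernoff bounds control all counts at once
(`sampleLaw_badSamples_le`), so with high posterior probability every split lies within such a
radius of the true one (`exists_lintegral_posterior_farSplits_le`).

The rest is deterministic. The radii grow at least by √2 per level, so the error accumulated along a
branch is comparable to the last one (`treeMass_sub_le`), and the Haar coefficients of level l are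
off by a multiple of √(l+1)/√n or √(log n)/√n, which the weights absorb. Smoothness enters only
beyond the cut-off, where the histogram has no Haar coefficients and those of f₀ are o(n^(-1/2))
uniformly over the class (`eventually_haarCoeff_high_le`). -/

theorem lintegral_fin_pi_prod {n : ℕ} {E : Fin n → Type*}
    {mE : ∀ i, MeasurableSpace (E i)} {μ : (i : Fin n) → Measure (E i)} [∀ i, SigmaFinite (μ i)]
    (f : (i : Fin n) → E i → ℝ≥0∞) (hf : ∀ i, Measurable (f i)) :
    ∫⁻ x : (i : Fin n) → E i, ∏ i, f i (x i) ∂(Measure.pi μ) = ∏ i, ∫⁻ x, f i x ∂(μ i) := by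
  induction n with
  | zero => simp
  | succ n ih =>
    calc
      _ = ∫⁻ x : E 0 × ((i : Fin n) → E (Fin.succ i)),
            f 0 x.1 * ∏ i : Fin n, f (Fin.succ i) (x.2 i)
            ∂((μ 0).prod (Measure.pi (fun i ↦ μ i.succ))) := by
        rw [← ((measurePreserving_piFinSuccAbove μ 0).symm).lintegral_comp_emb
          (MeasurableEquiv.measurableEmbedding _)]
        simp_rw [MeasurableEquiv.piFinSuccAbove_symm_apply, Fin.insertNthEquiv,
          Fin.prod_univ_succ, Fin.insertNth_zero, Equiv.coe_fn_mk, Fin.cons_succ,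
          Fin.zero_succAbove, Fin.cons_zero]
        rfl
      _ = (∫⁻ x, f 0 x ∂μ 0)
            * ∏ i : Fin n, ∫⁻ (x : E (Fin.succ i)), f (Fin.succ i) x ∂(μ i.succ) := by
        rw [← ih _ fun i => hf _, ← lintegral_prod_mul (hf 0).aemeasurable]
        exact (Finset.measurable_prod _ fun i _ =>
          (hf _).comp (measurable_pi_apply i)).aemeasurable
      _ = ∏ i, ∫⁻ x, f i x ∂(μ i) := by rw [Fin.prod_univ_succ]

theorem lintegral_pi_prod {ι : Type*} [Fintype ι] {E : ι → Type*}
    {mE : ∀ i, MeasurableSpace (E i)} {μ : (i : ι) → Measure (E i)} [∀ i, SigmaFinite (μ i)]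
    (f : (i : ι) → E i → ℝ≥0∞) (hf : ∀ i, Measurable (f i)) :
    ∫⁻ x : (i : ι) → E i, ∏ i, f i (x i) ∂(Measure.pi μ) = ∏ i, ∫⁻ x, f i x ∂(μ i) := by
  let e := (Fintype.equivFin ι).symm
  rw [← (measurePreserving_piCongrLeft _ e).lintegral_comp_emb
    (MeasurableEquiv.measurableEmbedding _)]
  simp_rw [← e.prod_comp, MeasurableEquiv.coe_piCongrLeft, Equiv.piCongrLeft_apply_apply]
  exact lintegral_fin_pi_prod _ fun i => hf _

theorem pi_withDensity {ι : Type*} [Fintype ι] {E : ι → Type*}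
    {mE : ∀ i, MeasurableSpace (E i)} {μ : (i : ι) → Measure (E i)} [∀ i, SigmaFinite (μ i)]
    (f : (i : ι) → E i → ℝ≥0∞) (hf : ∀ i, Measurable (f i))
    [∀ i, SigmaFinite ((μ i).withDensity (f i))] :
    Measure.pi (fun i => (μ i).withDensity (f i))
      = (Measure.pi μ).withDensity fun x => ∏ i, f i (x i) := by
  refine Measure.pi_eq fun s hs => ?_
  rw [withDensity_apply _ (MeasurableSet.univ_pi hs), ← lintegral_indicator
    (MeasurableSet.univ_pi hs)]
  have : (fun x : (i : ι) → E i => (univ.pi s).indicator (fun x => ∏ i, f i (x i)) x)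
      = fun x => ∏ i, (s i).indicator (f i) (x i) := by
    ext x
    by_cases hx : x ∈ univ.pi s
    · rw [indicator_of_mem hx]
      exact Finset.prod_congr rfl fun i _ => (indicator_of_mem (hx i (mem_univ i)) _).symm
    · rw [indicator_of_notMem hx]
      simp only [mem_univ_pi, not_forall] at hx
      obtain ⟨i, hi⟩ := hx
      exact (Finset.prod_eq_zero (Finset.mem_univ i) (indicator_of_notMem hi _)).symm
  rw [this, lintegral_pi_prod _ fun i => (hf i).indicator (hs i)]
  refine Finset.prod_congr rfl fun i _ => ?_
  rw [lintegral_indicator (hs i), withDensity_apply _ (hs i)]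

variable {Ω 𝓧 : Type*} {mΩ : MeasurableSpace Ω} {m𝓧 : MeasurableSpace 𝓧}
    [StandardBorelSpace Ω] [Nonempty Ω]

/-- Bayes' formula without division, so that a marginal likelihood equal to 0 or ∞ causes no
trouble. Integrated over any measurable S, both sides give the joint probability of S and B. -/
theorem posterior_mul_marginal_ae_eq (κ : Kernel Ω 𝓧) [IsMarkovKernel κ] (μ : Measure Ω)
    [IsFiniteMeasure μ] (ν : Measure 𝓧) [SigmaFinite ν] (lik : Ω → 𝓧 → ℝ≥0∞)
    (hlik : Measurable (Function.uncurry lik)) (hκ : ∀ ω, κ ω = ν.withDensity (lik ω))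
    {B : Set Ω} (hB : MeasurableSet B) :
    ∀ᵐ x ∂ν, posterior κ μ x B * ∫⁻ ω, lik ω x ∂μ = ∫⁻ ω in B, lik ω x ∂μ := by
  have hswap : Measurable (Function.uncurry fun x ω => lik ω x) := hlik.comp measurable_swap
  have hm : Measurable fun x => ∫⁻ ω, lik ω x ∂μ := hswap.lintegral_prod_right'
  have hmB : Measurable fun x => ∫⁻ ω in B, lik ω x ∂μ := hswap.lintegral_prod_right'
  have hint : ∀ (A : Set Ω) (S : Set 𝓧), MeasurableSet S →
      ∫⁻ ω in A, κ ω S ∂μ = ∫⁻ x in S, ∫⁻ ω in A, lik ω x ∂μ ∂ν := by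
    intro A S hS
    rw [lintegral_lintegral_swap hswap.aemeasurable]
    refine lintegral_congr fun ω => ?_
    rw [hκ, withDensity_apply _ hS]
  have hmarg : κ ∘ₘ μ = ν.withDensity fun x => ∫⁻ ω, lik ω x ∂μ := by
    ext S hS
    rw [Measure.bind_apply hS κ.aemeasurable, withDensity_apply _ hS]
    simpa using hint univ S hS
  have hp : Measurable fun x => posterior κ μ x B := Kernel.measurable_coe _ hB
  refine ae_eq_of_forall_setLIntegral_eq_of_sigmaFinite (hp.mul hm) hmB fun S hS _ => ?_
  have h1 := congrArg (fun m => m (S ×ˢ B)) (compProd_posterior_eq_map_swap (κ := κ) (μ := μ))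
  rw [Measure.compProd_apply_prod hS hB, Measure.map_apply measurable_swap (hS.prod hB),
    preimage_swap_prod, Measure.compProd_apply_prod hB hS, hint B S hS, hmarg,
    restrict_withDensity hS, lintegral_withDensity_eq_lintegral_mul _ hm hp] at h1
  rw [← h1]
  refine lintegral_congr fun x => ?_
  simp [mul_comm]

/-- The bound r is quantified inside the almost-everywhere statement, so the integral inequality
need only be checked at the sample at hand, for instance a good one. -/
theorem posterior_le_of_lintegral_le (κ : Kernel Ω 𝓧) [IsMarkovKernel κ] (μ : Measure Ω)
    [IsFiniteMeasure μ] (ν : Measure 𝓧) [SigmaFinite ν] (lik : Ω → 𝓧 → ℝ≥0∞)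
    (hlik : Measurable (Function.uncurry lik)) (hκ : ∀ ω, κ ω = ν.withDensity (lik ω))
    {B : Set Ω} (hB : MeasurableSet B) :
    ∀ᵐ x ∂ν, ∀ r : ℝ≥0∞, ∫⁻ ω, lik ω x ∂μ ≠ 0 → ∫⁻ ω, lik ω x ∂μ ≠ ∞ →
      ∫⁻ ω in B, lik ω x ∂μ ≤ r * ∫⁻ ω, lik ω x ∂μ → posterior κ μ x B ≤ r := by
  filter_upwards [posterior_mul_marginal_ae_eq κ μ ν lik hlik hκ hB] with x hx r h0 htop hr
  rw [← hx] at hr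
  exact (ENNReal.mul_le_mul_iff_left h0 htop).1 hr

end Generic

/-- A constraint on coordinate i changes only the i-th factor of the product integral; all other
factors cancel. This is how prior independence becomes a statement about posterior marginals. -/
theorem setLIntegral_pi_prod_le {ι : Type*} [Fintype ι] {E : Type*}
    {mE : MeasurableSpace E} {μ : ι → Measure E} [∀ i, SigmaFinite (μ i)]
    (g : ι → E → ℝ≥0∞) (hg : ∀ i, Measurable (g i)) (i : ι) {B : Set E} (hB : MeasurableSet B)
    (r : ℝ≥0∞) (h : ∫⁻ y in B, g i y ∂(μ i) ≤ r * ∫⁻ y, g i y ∂(μ i)) :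
    ∫⁻ x in {x : ι → E | x i ∈ B}, ∏ j, g j (x j) ∂(Measure.pi μ)
      ≤ r * ∫⁻ x, ∏ j, g j (x j) ∂(Measure.pi μ) := by
  classical
  have hS : MeasurableSet {x : ι → E | x i ∈ B} := measurable_pi_apply i hB
  let f : ι → E → ℝ≥0∞ := fun j => if j = i then B.indicator (g j) else g j
  have hf : ∀ j, Measurable (f j) := by
    intro j
    by_cases hj : j = i
    · simpa [f, hj] using (hg i).indicator hB
    · simpa [f, hj] using hg j
  have hfi : f i = B.indicator (g i) := by simp [f]
  have hne : ∀ j ∈ Finset.univ.erase i, f j = g j := fun j hj => by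
    simp [f, Finset.ne_of_mem_erase hj]
  have hind : ∀ x : ι → E, {x : ι → E | x i ∈ B}.indicator (fun x => ∏ j, g j (x j)) x
      = ∏ j, f j (x j) := by
    intro x
    rw [← Finset.mul_prod_erase _ _ (Finset.mem_univ i), hfi,
      Finset.prod_congr rfl fun j hj => by rw [hne j hj]]
    by_cases hx : x i ∈ B
    · rw [indicator_of_mem (by exact hx), indicator_of_mem hx,
        Finset.mul_prod_erase _ (fun j => g j (x j)) (Finset.mem_univ i)]
    · rw [indicator_of_notMem (by exact hx), indicator_of_notMem hx, zero_mul]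
  rw [← lintegral_indicator hS, lintegral_congr hind, lintegral_pi_prod f hf,
    lintegral_pi_prod g hg, ← Finset.mul_prod_erase _ _ (Finset.mem_univ i),
    ← Finset.mul_prod_erase _ (fun j => ∫⁻ x, g j x ∂μ j) (Finset.mem_univ i), ← mul_assoc,
    Finset.prod_congr rfl fun j hj => by rw [hne j hj], hfi, lintegral_indicator hB]
  gcongr

/-! ### Dyadic intervals -/

/-- The dyadic interval `(k/2^l, (k+1)/2^l]`. -/
def dyadic (l k : ℕ) : Set ℝ := Ioc ((k : ℝ) / 2 ^ l) (((k : ℝ) + 1) / 2 ^ l)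

/-- The position of the dyadic interval of level `l` that contains `x ∈ (0, 1]`. -/
def dyadicIndex (l : ℕ) (x : ℝ) : ℕ := ⌈(2 : ℝ) ^ l * x⌉₊ - 1

/-- Positivity matters: for x ≤ 0 the truncated subtraction returns index 0, although no dyadic
interval contains x. -/
theorem mem_dyadic_iff {l k : ℕ} {x : ℝ} (hx : 0 < x) : x ∈ dyadic l k ↔ dyadicIndex l x = k := by
  have h2 : (0 : ℝ) < 2 ^ l := by positivity
  have hpos : 0 < ⌈(2 : ℝ) ^ l * x⌉₊ := Nat.ceil_pos.2 (by positivity)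
  have h : dyadicIndex l x = k ↔ ⌈(2 : ℝ) ^ l * x⌉₊ = k + 1 := by
    unfold dyadicIndex; omega
  rw [h, Nat.ceil_eq_iff (by omega), dyadic, mem_Ioc, div_lt_iff₀ h2, le_div_iff₀ h2]
  push_cast
  simp [mul_comm x]

theorem measurableSet_dyadic (l k : ℕ) : MeasurableSet (dyadic l k) := measurableSet_Ioc

theorem measurable_dyadicIndex (l : ℕ) : Measurable (dyadicIndex l) := by
  unfold dyadicIndex
  exact (measurable_of_countable fun n : ℕ => n - 1).comp
    (Nat.measurable_ceil.comp (measurable_const.mul measurable_id))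

theorem dyadicIndex_lt {l : ℕ} {x : ℝ} (hx : x ≤ 1) : dyadicIndex l x < 2 ^ l := by
  have h : ⌈(2 : ℝ) ^ l * x⌉₊ ≤ 2 ^ l := by
    rw [Nat.ceil_le]; push_cast
    exact mul_le_of_le_one_right (by positivity) hx
  have : 0 < 2 ^ l := by positivity
  unfold dyadicIndex; omega

theorem dyadic_eq_union_children {l k : ℕ} :
    dyadic l k = dyadic (l + 1) (2 * k) ∪ dyadic (l + 1) (2 * k + 1) := by
  unfold dyadic
  have h2 : (0 : ℝ) < 2 ^ l := by positivity
  have h3 : (((2 * k : ℕ) : ℝ) + 1) / 2 ^ (l + 1) = ((2 * k + 1 : ℕ) : ℝ) / 2 ^ (l + 1) := by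
    push_cast; rfl
  rw [h3, Ioc_union_Ioc_eq_Ioc]
  · congr 1
    · push_cast; rw [pow_succ]; field_simp
    · push_cast; rw [pow_succ]; field_simp; ring
  · gcongr; simp
  · gcongr; simp

theorem dyadicIndex_succ_div (l : ℕ) {x : ℝ} (hx : 0 < x) :
    dyadicIndex (l + 1) x / 2 = dyadicIndex l x := by
  have h := (mem_dyadic_iff (l := l) hx).2 rfl
  rw [dyadic_eq_union_children, mem_union, mem_dyadic_iff hx, mem_dyadic_iff hx] at h
  omega

theorem treeDensity_apply {L : ℕ} (Y : Splits L) {x : ℝ} (hx : x ∈ Ioc (0 : ℝ) 1) :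
    treeDensity L Y x = 2 ^ L * treeMass (splitAt Y) L (dyadicIndex L x) := by
  unfold treeDensity
  have hk := dyadicIndex_lt (l := L) hx.2
  rw [Finset.sum_eq_single_of_mem _ (Finset.mem_range.2 hk)]
  · rw [indicator_of_mem]
    exact (mem_dyadic_iff hx.1).2 rfl
  · intro k _ hne
    rw [indicator_of_notMem]
    exact fun h => hne ((mem_dyadic_iff hx.1).1 h).symm

/-! ### The likelihood -/

/-- The number of observations in the dyadic interval `(l, k)`. -/
def count {n : ℕ} (X : Fin n → ℝ) (l k : ℕ) : ℕ :=
  (Finset.univ.filter fun i => dyadicIndex l (X i) = k).card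

theorem count_children {n : ℕ} {X : Fin n → ℝ} (hX : ∀ i, 0 < X i) (l k : ℕ) :
    count X (l + 1) (2 * k) + count X (l + 1) (2 * k + 1) = count X l k := by
  unfold count
  rw [← Finset.card_union_of_disjoint]
  · congr 1
    ext i
    have := dyadicIndex_succ_div l (hX i)
    simp only [Finset.mem_union, Finset.mem_filter, Finset.mem_univ, true_and]
    omega
  · rw [Finset.disjoint_filter]
    intro i _ h
    omega

theorem count_le {n : ℕ} (X : Fin n → ℝ) (l k : ℕ) : count X l k ≤ n := by
  simpa [count] using Finset.card_filter_le (s := Finset.univ)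
    (p := fun i : Fin n => dyadicIndex l (X i) = k)

/-- Every observation picks one factor per level along its branch. Grouping the factors of the last
level by parent node gives one power for each child. -/
theorem prod_treeMass_eq {n : ℕ} {X : Fin n → ℝ} (hX : ∀ i, X i ∈ Ioc (0 : ℝ) 1)
    (y : ℕ → ℕ → ℝ) (l : ℕ) :
    ∏ i, treeMass y l (dyadicIndex l (X i)) = ∏ j ∈ Finset.range l, ∏ k ∈ Finset.range (2 ^ j),
      (y j k ^ count X (j + 1) (2 * k) * (1 - y j k) ^ count X (j + 1) (2 * k + 1)) := by
  induction l with
  | zero => simp [treeMass]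
  | succ l ih =>
    rw [Finset.prod_range_succ, ← ih]
    simp only [treeMass]
    rw [Finset.prod_mul_distrib]
    congr 1
    · exact Finset.prod_congr rfl fun i _ => by rw [dyadicIndex_succ_div l (hX i).1]
    · rw [← Finset.prod_fiberwise_of_maps_to (s := Finset.univ) (t := Finset.range (2 ^ l))
        (g := fun i => dyadicIndex l (X i))
        fun i _ => Finset.mem_range.2 (dyadicIndex_lt (hX i).2)]
      refine Finset.prod_congr rfl fun k _ => ?_
      have h1 : ∀ i ∈ Finset.univ.filter fun i => dyadicIndex l (X i) = k,
          (if dyadicIndex (l + 1) (X i) % 2 = 0 then y l (dyadicIndex (l + 1) (X i) / 2)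
            else 1 - y l (dyadicIndex (l + 1) (X i) / 2))
          = if dyadicIndex (l + 1) (X i) % 2 = 0 then y l k else 1 - y l k := by
        intro i hi
        rw [dyadicIndex_succ_div l (hX i).1, (Finset.mem_filter.1 hi).2]
      rw [Finset.prod_congr rfl h1, Finset.prod_ite, Finset.prod_const, Finset.prod_const,
        Finset.filter_filter, Finset.filter_filter]
      unfold count
      congr 3 <;>
      · ext i
        have := dyadicIndex_succ_div l (hX i).1
        simp only [Finset.mem_filter, Finset.mem_univ, true_and]
        omega

/-- The factor of the likelihood that involves the splitting variable of the node `(l, k)`. -/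
def nodeLikelihood {n : ℕ} (X : Fin n → ℝ) (l k : ℕ) (y : I) : ℝ≥0∞ :=
  ENNReal.ofReal ((y : ℝ) ^ count X (l + 1) (2 * k) * (1 - (y : ℝ)) ^ count X (l + 1) (2 * k + 1))

theorem measurable_nodeLikelihood {n : ℕ} (X : Fin n → ℝ) (l k : ℕ) :
    Measurable (nodeLikelihood X l k) := by
  unfold nodeLikelihood
  fun_prop

theorem nodeLikelihood_le_one {n : ℕ} (X : Fin n → ℝ) (l k : ℕ) (y : I) :
    nodeLikelihood X l k y ≤ 1 := by
  unfold nodeLikelihood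
  rw [ENNReal.ofReal_le_one]
  have h0 : (0 : ℝ) ≤ 1 - y := by linarith [y.2.2]
  exact mul_le_one₀ (pow_le_one₀ y.2.1 y.2.2) (pow_nonneg h0 _)
    (pow_le_one₀ h0 (by linarith [y.2.1]))

/-- The likelihood of the splitting variables. -/
def likelihood {L n : ℕ} (Y : Splits L) (X : Fin n → ℝ) : ℝ≥0∞ :=
  ∏ i, ENNReal.ofReal (treeDensity L Y (X i))

theorem measurable_likelihood (L n : ℕ) :
    Measurable (Function.uncurry (likelihood (L := L) (n := n))) := by
  unfold likelihood Function.uncurry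
  refine Finset.measurable_prod _ fun i _ => ENNReal.measurable_ofReal.comp ?_
  exact (measurable_treeDensity L).comp
    (measurable_fst.prodMk ((measurable_pi_apply i).comp measurable_snd))

theorem treeDensity_nonneg {L : ℕ} (Y : Splits L) (x : ℝ) : 0 ≤ treeDensity L Y x :=
  Finset.sum_nonneg fun _ _ => indicator_nonneg
    (fun _ _ => mul_nonneg (by positivity) (treeMass_nonneg Y L _)) x

theorem likelihood_eq_prod {L n : ℕ} (Y : Splits L) {X : Fin n → ℝ}
    (hX : ∀ i, X i ∈ Ioc (0 : ℝ) 1) :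
    likelihood Y X = ENNReal.ofReal (((2 : ℝ) ^ L) ^ n)
      * ∏ ν : Node L, nodeLikelihood X ν.1 ν.2 (Y ν) := by
  have hnn : ∀ ν ∈ (Finset.univ : Finset (Node L)), 0 ≤ (Y ν : ℝ) ^ count X (ν.1 + 1) (2 * ν.2)
      * (1 - (Y ν : ℝ)) ^ count X (ν.1 + 1) (2 * ν.2 + 1) := by
    intro ν _
    have h0 : (0 : ℝ) ≤ 1 - Y ν := by linarith [(Y ν).2.2]
    have := (Y ν).2.1
    positivity
  unfold likelihood nodeLikelihood
  rw [← ENNReal.ofReal_prod_of_nonneg fun i _ => treeDensity_nonneg Y (X i),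
    ← ENNReal.ofReal_prod_of_nonneg hnn, ← ENNReal.ofReal_mul (by positivity)]
  congr 1
  rw [Finset.prod_congr rfl fun i _ => treeDensity_apply Y (hX i), Finset.prod_mul_distrib,
    Finset.prod_const, Finset.card_univ, Fintype.card_fin, prod_treeMass_eq hX,
    Fintype.prod_sigma, Finset.prod_range]
  congr 1
  refine Finset.prod_congr rfl fun l _ => ?_
  rw [Finset.prod_range]
  refine Finset.prod_congr rfl fun k _ => ?_
  have : splitAt Y l k = Y ⟨l, k⟩ := by simp [splitAt]
  rw [this]

/-- Lebesgue measure on `[0,1]`. -/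
def unitVolume : Measure ℝ := volume.restrict (Icc (0 : ℝ) 1)

instance : IsProbabilityMeasure unitVolume := ⟨by simp [unitVolume]⟩

theorem ae_unitVolume_mem : ∀ᵐ x ∂unitVolume, x ∈ Ioc (0 : ℝ) 1 := by
  unfold unitVolume
  rw [← restrict_Ioc_eq_restrict_Icc]
  exact ae_restrict_mem measurableSet_Ioc

theorem ae_pi_unitVolume_mem (n : ℕ) :
    ∀ᵐ X ∂(Measure.pi fun _ : Fin n => unitVolume), ∀ i, X i ∈ Ioc (0 : ℝ) 1 := by
  rw [ae_all_iff]
  exact fun i => (Measure.quasiMeasurePreserving_eval _ i).ae ae_unitVolume_mem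

theorem model_eq_withDensity (L n : ℕ) (Y : Splits L) :
    model L n Y = (Measure.pi fun _ : Fin n => unitVolume).withDensity (likelihood Y) := by
  have := isProbabilityMeasure_tree L Y
  have h : Measurable fun x => ENNReal.ofReal (treeDensity L Y x) :=
    ((measurable_treeDensity L).comp measurable_prodMk_left).ennreal_ofReal
  have hs : ∀ _ : Fin n, SigmaFinite (unitVolume.withDensity
      fun x => ENNReal.ofReal (treeDensity L Y x)) := fun _ =>
    inferInstanceAs (SigmaFinite (densityMeasure (treeDensity L Y)))
  exact pi_withDensity (fun _ : Fin n => fun x => ENNReal.ofReal (treeDensity L Y x)) fun _ => h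

theorem slabWeight_pos (κ : ℝ) (l₀ l : ℕ) : 0 < slabWeight κ l₀ l := by
  unfold slabWeight; split_ifs <;> positivity

/-- The slab has positive weight, and the node likelihood is positive on (0,1), which carries the
Beta law. -/
theorem lintegral_nodeLikelihood_ne_zero (a : ℕ+) {p : ℝ} (hp : 0 < p) {n : ℕ} (X : Fin n → ℝ)
    (l k : ℕ) : ∫⁻ y, nodeLikelihood X l k y ∂(splitLaw a p) ≠ 0 := by
  have ha : (0 : ℝ) < ((a : ℕ) : ℝ) := by exact_mod_cast a.pos
  have := isProbabilityMeasureBeta ha ha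
  intro h
  rw [lintegral_eq_zero_iff (measurable_nodeLikelihood X l k), Filter.EventuallyEq, ae_iff] at h
  have h1 : (betaMeasure (a : ℕ) (a : ℕ)).comap Subtype.val
      {y : I | ¬ nodeLikelihood X l k y = (0 : I → ℝ≥0∞) y} = 0 := by
    rw [splitLaw, Measure.add_apply, Measure.smul_apply, Measure.smul_apply, add_eq_zero] at h
    exact (mul_eq_zero.1 h.2).resolve_left (by simpa using hp)
  rw [(MeasurableEmbedding.subtype_coe measurableSet_Icc).comap_apply] at h1
  have hsub : Ioo (0 : ℝ) 1 ⊆ Subtype.val '' {y : I | ¬ nodeLikelihood X l k y = 0} := by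
    intro y hy
    refine ⟨⟨y, hy.1.le, hy.2.le⟩, ?_, rfl⟩
    have h3 : 0 < y := hy.1
    have h4 : 0 < 1 - y := by linarith [hy.2]
    simp only [mem_ofPred_eq, nodeLikelihood, ENNReal.ofReal_eq_zero, not_le]
    positivity
  have h2 : betaMeasure (a : ℕ) (a : ℕ) (Ioo 0 1)ᶜ = 0 := by
    rw [betaMeasure, withDensity_apply _ measurableSet_Ioo.compl]
    refine setLIntegral_eq_zero measurableSet_Ioo.compl fun x hx => ?_
    have hx' : ¬ (0 < x ∧ x < 1) := hx
    simp [betaPDF_eq, hx']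
  have h5 := measure_union_null (measure_mono_null hsub h1) h2
  rw [union_compl_self, measure_univ] at h5
  exact one_ne_zero h5

theorem posterior_split_le (a : ℕ+) (κ : ℝ) (l₀ n : ℕ) (ν : Node (cutoff n)) {B : Set I}
    (hB : MeasurableSet B) :
    ∀ᵐ X ∂(Measure.pi fun _ : Fin n => unitVolume), ∀ r : ℝ≥0∞,
      ∫⁻ y in B, nodeLikelihood X ν.1 ν.2 y ∂(splitLaw a (slabWeight κ l₀ ν.1))
        ≤ r * ∫⁻ y, nodeLikelihood X ν.1 ν.2 y ∂(splitLaw a (slabWeight κ l₀ ν.1)) →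
      posteriorLaw a κ l₀ n X {Y | Y ν ∈ B} ≤ r := by
  have hS : MeasurableSet {Y : Splits (cutoff n) | Y ν ∈ B} := measurable_pi_apply ν hB
  have hpost := posterior_le_of_lintegral_le (model (cutoff n) n) (prior a κ l₀ (cutoff n))
    (Measure.pi fun _ : Fin n => unitVolume) likelihood (measurable_likelihood _ _)
    (model_eq_withDensity _ _) hS
  filter_upwards [hpost, ae_pi_unitVolume_mem n] with X hX hmem r hr
  have hlik : ∀ Y : Splits (cutoff n), likelihood Y X = _ := fun Y => likelihood_eq_prod Y hmem
  have hmeas : Measurable fun Y : Splits (cutoff n) =>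
      ∏ ν : Node (cutoff n), nodeLikelihood X ν.1 ν.2 (Y ν) :=
    Finset.measurable_prod _ fun ν _ =>
      (measurable_nodeLikelihood X ν.1 ν.2).comp (measurable_pi_apply ν)
  have hprod : ∫⁻ Y, ∏ ν : Node (cutoff n), nodeLikelihood X ν.1 ν.2 (Y ν)
      ∂(prior a κ l₀ (cutoff n)) = _ :=
    lintegral_pi_prod _ fun ν => measurable_nodeLikelihood X ν.1 ν.2
  refine hX r ?_ ?_ ?_
  · rw [lintegral_congr hlik, lintegral_const_mul _ hmeas, hprod]
    refine mul_ne_zero (by simp) (Finset.prod_ne_zero_iff.2 fun ν _ => ?_)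
    exact lintegral_nodeLikelihood_ne_zero a (slabWeight_pos _ _ _) X _ _
  · rw [lintegral_congr hlik, lintegral_const_mul _ hmeas]
    refine ENNReal.mul_ne_top ENNReal.ofReal_ne_top (ne_of_lt ?_)
    calc _ ≤ ∫⁻ _, 1 ∂(prior a κ l₀ (cutoff n)) :=
          lintegral_mono fun Y => Finset.prod_le_one' fun ν _ => nodeLikelihood_le_one _ _ _ _
      _ < ∞ := by simp
  · rw [lintegral_congr hlik, lintegral_congr hlik, lintegral_const_mul _ hmeas,
      lintegral_const_mul _ hmeas, mul_left_comm]
    gcongr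
    exact setLIntegral_pi_prod_le (fun ν : Node (cutoff n) => nodeLikelihood X ν.1 ν.2)
      (fun ν => measurable_nodeLikelihood X ν.1 ν.2) ν hB r hr

/-! ### Posterior concentration at one node -/

theorem sq_sub_le_four_mul_sq_sqrt_sub {x y : ℝ} (hx : 0 ≤ x) (hx1 : x ≤ 1) (hy : 0 ≤ y)
    (hy1 : y ≤ 1) : (x - y) ^ 2 ≤ 4 * (√x - √y) ^ 2 := by
  have h1 : x - y = (√x - √y) * (√x + √y) := by
    nlinarith [Real.sq_sqrt hx, Real.sq_sqrt hy]
  have h2 : √x ≤ 1 := Real.sqrt_le_one.2 hx1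
  have h3 : √y ≤ 1 := Real.sqrt_le_one.2 hy1
  have h4 : (√x + √y) ^ 2 ≤ 4 := by nlinarith [Real.sqrt_nonneg x, Real.sqrt_nonneg y]
  rw [h1, mul_pow, mul_comm]
  gcongr

/-- This is log u ≤ 2(√u - 1). The square root is what produces a Hellinger distance when the two
binomial factors are combined. -/
theorem div_pow_le_exp {x z : ℝ} (hx : 0 ≤ x) (hz : 0 < z) (m : ℕ) :
    (x / z) ^ m ≤ Real.exp (m * (2 * (√x / √z - 1))) := by
  rw [Real.exp_nat_mul]
  refine pow_le_pow_left₀ (by positivity) ?_ m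
  have h : x / z = (√x / √z) ^ 2 := by rw [div_pow, Real.sq_sqrt hx, Real.sq_sqrt hz.le]
  rw [h, two_mul, Real.exp_add, sq]
  have := Real.add_one_le_exp (√x / √z - 1)
  gcongr <;> linarith

variable {N₀ N₁ : ℕ} {z : ℝ}

/-- The binomial likelihood with maximiser `z` decays like a Gaussian away from `z`. -/
theorem pow_mul_pow_le (hz : 0 < z) (hz1 : z < 1) (hN₀ : (N₀ : ℝ) = (N₀ + N₁) * z) {y : ℝ}
    (hy : 0 ≤ y) (hy1 : y ≤ 1) :
    y ^ N₀ * (1 - y) ^ N₁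
      ≤ z ^ N₀ * (1 - z) ^ N₁ * Real.exp (-((N₀ + N₁) * (y - z) ^ 2 / 2)) := by
  have hN₁ : (N₁ : ℝ) = (N₀ + N₁) * (1 - z) := by linarith
  have hz' : 0 < 1 - z := by linarith
  have hy' : 0 ≤ 1 - y := by linarith
  have h0 := div_pow_le_exp hy hz N₀
  have h1 := div_pow_le_exp hy' hz' N₁
  have hprod : (y / z) ^ N₀ * ((1 - y) / (1 - z)) ^ N₁
      ≤ Real.exp (-((N₀ + N₁) * (y - z) ^ 2 / 2)) := by
    refine (mul_le_mul h0 h1 (by positivity) (by positivity)).trans ?_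
    rw [← Real.exp_add, Real.exp_le_exp]
    have e0 : (N₀ : ℝ) * (2 * (√y / √z - 1)) = (N₀ + N₁) * (2 * (√y * √z - z)) := by
      rw [hN₀]
      have : √y / √z * z = √y * √z := by
        rw [div_mul_eq_mul_div, div_eq_iff (by positivity), mul_assoc, Real.mul_self_sqrt hz.le]
      rw [← hN₀]; linear_combination (2 * (√y / √z - 1)) * hN₀ + 2 * (N₀ + N₁) * this
    have e1 : (N₁ : ℝ) * (2 * (√(1 - y) / √(1 - z) - 1))
        = (N₀ + N₁) * (2 * (√(1 - y) * √(1 - z) - (1 - z))) := by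
      have : √(1 - y) / √(1 - z) * (1 - z) = √(1 - y) * √(1 - z) := by
        rw [div_mul_eq_mul_div, div_eq_iff (by positivity), mul_assoc, Real.mul_self_sqrt hz'.le]
      linear_combination (2 * (√(1 - y) / √(1 - z) - 1)) * hN₁ + 2 * (N₀ + N₁) * this
    rw [e0, e1, ← mul_add, ← mul_div_assoc', ← mul_neg]
    refine mul_le_mul_of_nonneg_left ?_ (by positivity)
    -- The exponent is -(N₀ + N₁) times (√y - √z)² + (√(1-y) - √(1-z))², and each of these two
    -- squares is at least (y-z)²/4.
    have q0 := sq_sub_le_four_mul_sq_sqrt_sub hy hy1 hz.le hz1.le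
    have q1 := sq_sub_le_four_mul_sq_sqrt_sub hy' (by linarith) hz'.le (by linarith)
    nlinarith [Real.sq_sqrt hy, Real.sq_sqrt hy', Real.sq_sqrt hz.le, Real.sq_sqrt hz'.le]
  calc y ^ N₀ * (1 - y) ^ N₁
      = z ^ N₀ * (1 - z) ^ N₁ * ((y / z) ^ N₀ * ((1 - y) / (1 - z)) ^ N₁) := by
        rw [div_pow, div_pow]; field_simp
    _ ≤ _ := by gcongr

/-- The Kullback–Leibler divergence of two Bernoulli laws is at most their χ² divergence, here
(y-z)²/(y(1-y)); the proof is log u ≤ u - 1 in each factor. -/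
theorem le_pow_mul_pow (hz : 0 ≤ z) (hz1 : z ≤ 1) (hN₀ : (N₀ : ℝ) = (N₀ + N₁) * z) {y : ℝ}
    (hy : 0 < y) (hy1 : y < 1) :
    z ^ N₀ * (1 - z) ^ N₁ * Real.exp (-((N₀ + N₁) * (y - z) ^ 2 / (y * (1 - y))))
      ≤ y ^ N₀ * (1 - y) ^ N₁ := by
  have hN₁ : (N₁ : ℝ) = (N₀ + N₁) * (1 - z) := by linarith
  have hy' : 0 < 1 - y := by linarith
  have hz' : 0 ≤ 1 - z := by linarith
  have key : ∀ (u v : ℝ) (m : ℕ), 0 ≤ u → 0 < v → (u / v) ^ m ≤ Real.exp (m * (u / v - 1)) := by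
    intro u v m hu hv
    rw [Real.exp_nat_mul]
    exact pow_le_pow_left₀ (by positivity)
      (by linarith [Real.add_one_le_exp (u / v - 1)]) m
  have hprod : (z / y) ^ N₀ * ((1 - z) / (1 - y)) ^ N₁
      ≤ Real.exp ((N₀ + N₁) * (y - z) ^ 2 / (y * (1 - y))) := by
    refine (mul_le_mul (key z y N₀ hz hy) (key _ _ N₁ hz' hy')
      (by positivity) (by positivity)).trans ?_
    rw [← Real.exp_add, Real.exp_le_exp]
    refine le_of_eq ?_
    have e : (N₀ + N₁ : ℝ) * (z * (z / y - 1) + (1 - z) * ((1 - z) / (1 - y) - 1))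
        = (N₀ + N₁) * (y - z) ^ 2 / (y * (1 - y)) := by
      field_simp; ring
    rw [← e]
    linear_combination (z / y - 1) * hN₀ + ((1 - z) / (1 - y) - 1) * hN₁
  calc _ = y ^ N₀ * (1 - y) ^ N₁ * (((z / y) ^ N₀ * ((1 - z) / (1 - y)) ^ N₁)
        * Real.exp (-((N₀ + N₁) * (y - z) ^ 2 / (y * (1 - y))))) := by
        rw [div_pow, div_pow]; field_simp
    _ ≤ y ^ N₀ * (1 - y) ^ N₁ * 1 := by
        gcongr
        rw [Real.exp_neg, ← div_eq_mul_inv]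
        exact div_le_one_of_le₀ hprod (by positivity)
    _ = _ := mul_one _

/-- Since a ≥ 1 the exponents a - 1 are nonnegative, so the density has no pole at the endpoints. -/
theorem betaPDFReal_le (a : ℕ+) (x : ℝ) :
    betaPDFReal (a : ℕ) (a : ℕ) x ≤ 1 / beta (a : ℕ) (a : ℕ) := by
  have ha : (1 : ℝ) ≤ ((a : ℕ) : ℝ) := by exact_mod_cast a.pos
  have hb : 0 < beta (a : ℕ) (a : ℕ) := beta_pos (by linarith) (by linarith)
  unfold betaPDFReal
  split_ifs with h
  · have h1 := Real.rpow_le_one h.1.le h.2.le (z := ((a : ℕ) : ℝ) - 1) (by linarith)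
    have h2 := Real.rpow_le_one (x := 1 - x) (by linarith) (by linarith [h.1])
      (z := ((a : ℕ) : ℝ) - 1) (by linarith)
    have h3 : 0 ≤ x ^ (((a : ℕ) : ℝ) - 1) := Real.rpow_nonneg h.1.le _
    have h4 : 0 ≤ (1 - x) ^ (((a : ℕ) : ℝ) - 1) := Real.rpow_nonneg (by linarith) _
    rw [mul_assoc]
    exact mul_le_of_le_one_right (by positivity) (mul_le_one₀ h1 h4 h2)
  · positivity

theorem le_betaPDFReal (a : ℕ+) {δ x : ℝ} (hδ : 0 < δ) (hx : δ ≤ x) (hx1 : x ≤ 1 - δ) :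
    1 / beta (a : ℕ) (a : ℕ) * (δ ^ (((a : ℕ) : ℝ) - 1) * δ ^ (((a : ℕ) : ℝ) - 1))
      ≤ betaPDFReal (a : ℕ) (a : ℕ) x := by
  have ha : (1 : ℝ) ≤ ((a : ℕ) : ℝ) := by exact_mod_cast a.pos
  have hb : 0 < beta (a : ℕ) (a : ℕ) := beta_pos (by linarith) (by linarith)
  rw [betaPDFReal, if_pos ⟨by linarith, by linarith⟩, mul_assoc]
  have hx0 : 0 < x := by linarith
  gcongr
  linarith

theorem setLIntegral_comap_betaMeasure (a : ℕ+) (g : ℝ → ℝ≥0∞) (hg : Measurable g) {B : Set ℝ}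
    (hB : MeasurableSet B) :
    ∫⁻ y in Subtype.val ⁻¹' B, g (y : ℝ)
        ∂((betaMeasure (a : ℕ) (a : ℕ)).comap (Subtype.val : I → ℝ))
      = ∫⁻ x in B ∩ Icc 0 1, ENNReal.ofReal (betaPDFReal (a : ℕ) (a : ℕ) x) * g x := by
  have hm : Measurable (betaPDF (a : ℕ) (a : ℕ)) :=
    (measurable_betaPDFReal _ _).ennreal_ofReal
  rw [setLIntegral_subtype measurableSet_Icc _ g, Subtype.image_preimage_coe, inter_comm,
    betaMeasure, restrict_withDensity (hB.inter measurableSet_Icc),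
    lintegral_withDensity_eq_lintegral_mul _ hm hg]
  rfl

theorem lintegral_exp_neg_mul_sq_sub (z : ℝ) {b : ℝ} (hb : 0 < b) :
    ∫⁻ x, ENNReal.ofReal (Real.exp (-b * (x - z) ^ 2)) = ENNReal.ofReal √(Real.pi / b) := by
  rw [lintegral_sub_right_eq_self (fun x => ENNReal.ofReal (Real.exp (-b * x ^ 2))) z,
    ← ofReal_integral_eq_lintegral_ofReal (integrable_exp_neg_mul_sq hb)
      (ae_of_all _ fun _ => by positivity), integral_gaussian]

/-- Upper bound for the contribution of the slab away from the maximiser of the likelihood. -/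
theorem setLIntegral_slab_le (a : ℕ+) (hN : 0 < N₀ + N₁) (hz : 0 < z) (hz1 : z < 1)
    (hN₀ : (N₀ : ℝ) = (N₀ + N₁) * z) {s : ℝ} {B : Set ℝ} (hB : MeasurableSet B)
    (hBs : ∀ y ∈ B, s ^ 2 ≤ (y - z) ^ 2) :
    ∫⁻ y in Subtype.val ⁻¹' B, ENNReal.ofReal ((y : ℝ) ^ N₀ * (1 - (y : ℝ)) ^ N₁)
        ∂((betaMeasure (a : ℕ) (a : ℕ)).comap (Subtype.val : I → ℝ))
      ≤ ENNReal.ofReal (1 / beta (a : ℕ) (a : ℕ) * (z ^ N₀ * (1 - z) ^ N₁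
        * Real.exp (-((N₀ + N₁) * s ^ 2 / 4))) * √(Real.pi / ((N₀ + N₁) / 4))) := by
  have ha : (0 : ℝ) < ((a : ℕ) : ℝ) := by exact_mod_cast a.pos
  have hb : 0 < beta (a : ℕ) (a : ℕ) := beta_pos ha ha
  have hN' : (0 : ℝ) < N₀ + N₁ := by exact_mod_cast hN
  have hz' : 0 < 1 - z := by linarith
  rw [setLIntegral_comap_betaMeasure a (fun y => ENNReal.ofReal (y ^ N₀ * (1 - y) ^ N₁))
    (by fun_prop) hB, ENNReal.ofReal_mul (by positivity),
    ← lintegral_exp_neg_mul_sq_sub z (b := (N₀ + N₁) / 4) (by positivity),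
    ← lintegral_const_mul _ (by fun_prop)]
  refine (setLIntegral_mono (by fun_prop) fun y hy => ?_).trans (setLIntegral_le_lintegral _ _)
  rw [← ENNReal.ofReal_mul' (mul_nonneg (pow_nonneg hy.2.1 _) (pow_nonneg
    (by linarith [hy.2.2]) _)), ← ENNReal.ofReal_mul (by positivity)]
  refine ENNReal.ofReal_le_ofReal ?_
  rw [mul_assoc]
  refine mul_le_mul (betaPDFReal_le a y) ?_ (mul_nonneg (pow_nonneg hy.2.1 _) (pow_nonneg
    (by linarith [hy.2.2]) _)) (by positivity)
  refine (pow_mul_pow_le hz hz1 hN₀ hy.2.1 hy.2.2).trans ?_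
  -- The exponent (y-z)²/2 is split in two halves: one gives the tail factor in s, the other is kept
  -- as an integrable Gaussian.
  rw [mul_assoc (z ^ N₀ * (1 - z) ^ N₁), ← Real.exp_add]
  gcongr
  nlinarith [hBs y hy.1]

/-- Lower bound for the evidence of the slab. -/
theorem le_lintegral_slab (a : ℕ+) (hN : 0 < N₀ + N₁) {δ : ℝ} (hδ : 0 < δ) (hz : 2 * δ ≤ z)
    (hz1 : z ≤ 1 - 2 * δ) (hN₀ : (N₀ : ℝ) = (N₀ + N₁) * z) :
    ENNReal.ofReal (1 / beta (a : ℕ) (a : ℕ)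
        * (δ ^ (((a : ℕ) : ℝ) - 1) * δ ^ (((a : ℕ) : ℝ) - 1))
        * (z ^ N₀ * (1 - z) ^ N₁ * Real.exp (-2 * δ)) * (2 * (δ / √(N₀ + N₁))))
      ≤ ∫⁻ y, ENNReal.ofReal ((y : ℝ) ^ N₀ * (1 - (y : ℝ)) ^ N₁)
        ∂((betaMeasure (a : ℕ) (a : ℕ)).comap (Subtype.val : I → ℝ)) := by
  have ha : (0 : ℝ) < ((a : ℕ) : ℝ) := by exact_mod_cast a.pos
  have hb : 0 < beta (a : ℕ) (a : ℕ) := beta_pos ha ha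
  have hN' : (1 : ℝ) ≤ N₀ + N₁ := by exact_mod_cast hN
  have hz0 : 0 < z := by linarith
  have hz' : 0 < 1 - z := by linarith
  have hsq : (1 : ℝ) ≤ √(N₀ + N₁) := Real.one_le_sqrt.2 hN'
  -- On the window of half-width h around z the χ² exponent stays below 2δ, and h ≤ δ keeps the
  -- window inside [δ, 1-δ]. Its length 2h is the source of the factor 1/√N.
  set h : ℝ := δ / √(N₀ + N₁) with hh
  have hhpos : 0 < h := by positivity
  have hhle : h ≤ δ := div_le_self hδ.le hsq
  have hsub : Icc (z - h) (z + h) ⊆ univ ∩ Icc 0 1 := fun y hy =>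
    ⟨mem_univ _, by linarith [hy.1], by linarith [hy.2]⟩
  rw [← setLIntegral_univ, ← preimage_univ (f := (Subtype.val : I → ℝ)),
    setLIntegral_comap_betaMeasure a (fun y => ENNReal.ofReal (y ^ N₀ * (1 - y) ^ N₁))
    (by fun_prop) MeasurableSet.univ]
  refine le_trans ?_ (lintegral_mono_set hsub)
  have hvol : ENNReal.ofReal (2 * h) = volume (Icc (z - h) (z + h)) := by
    rw [Real.volume_Icc]; congr 1; ring
  rw [ENNReal.ofReal_mul (by positivity), hvol, ← setLIntegral_const]
  refine setLIntegral_mono' measurableSet_Icc fun y hy => ?_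
  have hy0 : δ ≤ y := by linarith [hy.1]
  have hy1 : y ≤ 1 - δ := by linarith [hy.2]
  rw [← ENNReal.ofReal_mul' (mul_nonneg (pow_nonneg (by linarith) _) (pow_nonneg
    (by linarith) _))]
  refine ENNReal.ofReal_le_ofReal ?_
  refine mul_le_mul (le_betaPDFReal a hδ hy0 hy1) ?_ (by positivity)
    (le_trans (by positivity) (le_betaPDFReal a hδ hy0 hy1))
  refine le_trans ?_ (le_pow_mul_pow hz0.le (by linarith) hN₀ (y := y) (by linarith)
    (by linarith))
  gcongr
  have hden : δ / 2 ≤ y * (1 - y) := by nlinarith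
  have hnum : (N₀ + N₁) * (y - z) ^ 2 ≤ δ ^ 2 := by
    have h1 : (y - z) ^ 2 ≤ h ^ 2 := by nlinarith [hy.1, hy.2]
    have h2 : h ^ 2 = δ ^ 2 / (N₀ + N₁) := by rw [hh, div_pow, Real.sq_sqrt (by positivity)]
    rw [h2, le_div_iff₀ (by positivity)] at h1
    linarith
  have : (N₀ + N₁) * (y - z) ^ 2 / (y * (1 - y)) ≤ 2 * δ := by
    rw [div_le_iff₀ (by nlinarith)]
    nlinarith
  linarith

/-- The posterior of a splitting variable concentrates around the empirical split at a Gaussian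
rate; the factor `(1 - p) √N / p` accounts for the spike. -/
theorem exists_setLIntegral_splitLaw_le (a : ℕ+) {δ : ℝ} (hδ : 0 < δ) :
    ∃ C : ℝ, 0 < C ∧ ∀ (N₀ N₁ : ℕ) (p z s : ℝ) (B : Set ℝ), 0 < p → p ≤ 1 → 0 < N₀ + N₁ →
      δ ≤ z → z ≤ 1 - δ → (N₀ : ℝ) = (N₀ + N₁) * z → MeasurableSet B →
      (∀ y ∈ B, s ^ 2 ≤ (y - z) ^ 2) →
      ∫⁻ y in Subtype.val ⁻¹' B, ENNReal.ofReal ((y : ℝ) ^ N₀ * (1 - (y : ℝ)) ^ N₁)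
          ∂(splitLaw a p)
        ≤ ENNReal.ofReal (C * Real.exp (-((N₀ + N₁) * s ^ 2 / 4))
            * (1 + (1 - p) / p * √(N₀ + N₁)))
          * ∫⁻ y, ENNReal.ofReal ((y : ℝ) ^ N₀ * (1 - (y : ℝ)) ^ N₁) ∂(splitLaw a p) := by
  have ha : (0 : ℝ) < ((a : ℕ) : ℝ) := by exact_mod_cast a.pos
  have hb : 0 < beta (a : ℕ) (a : ℕ) := beta_pos ha ha
  set A : ℝ := 1 / beta (a : ℕ) (a : ℕ) with hA
  set b : ℝ := A * ((δ / 2) ^ (((a : ℕ) : ℝ) - 1) * (δ / 2) ^ (((a : ℕ) : ℝ) - 1))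
    * Real.exp (-2 * (δ / 2)) * (2 * (δ / 2)) with hbdef
  have hApos : 0 < A := by positivity
  have hbpos : 0 < b := by positivity
  refine ⟨(A * √(4 * Real.pi) + 1) / b, by positivity, ?_⟩
  intro N₀ N₁ p z s B hp hp1 hN hz hz1 hN₀ hB hBs
  have hN' : (0 : ℝ) < N₀ + N₁ := by exact_mod_cast hN
  have hz0 : 0 < z := by linarith
  have hz' : 0 < 1 - z := by linarith
  have hsq : (0 : ℝ) < √(N₀ + N₁) := Real.sqrt_pos.2 hN'
  have hp0 : 0 ≤ 1 - p := by linarith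
  set g : I → ℝ≥0∞ := fun y => ENNReal.ofReal ((y : ℝ) ^ N₀ * (1 - (y : ℝ)) ^ N₁) with hg
  set G : ℝ := z ^ N₀ * (1 - z) ^ N₁ with hG
  have hGpos : 0 < G := by positivity
  set e : ℝ := Real.exp (-((N₀ + N₁) * s ^ 2 / 4)) with he
  have hepos : 0 < e := Real.exp_pos _
  have hgm : Measurable g := by fun_prop
  have hB' : MeasurableSet (Subtype.val ⁻¹' B : Set I) := measurable_subtype_coe hB
  have hslab := setLIntegral_slab_le a hN hz0 (by linarith) hN₀ hB hBs
  have hlow := le_lintegral_slab a hN (half_pos hδ) (by linarith) (by linarith) hN₀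
  have hsqrt : √(Real.pi / ((N₀ + N₁) / 4)) = √(4 * Real.pi) / √(N₀ + N₁) := by
    rw [← Real.sqrt_div (by positivity)]; congr 1; field_simp
  have hspike : ∫⁻ y in Subtype.val ⁻¹' B, g y
      ∂(Measure.dirac (⟨1 / 2, by norm_num, by norm_num⟩ : I)) ≤ ENNReal.ofReal (G * e) := by
    rw [← lintegral_indicator hB', lintegral_dirac' _ (hgm.indicator hB')]
    -- If 1/2 lies in B it is at distance at least |s| from z, so the spike obeys the Gaussian
    -- bound; otherwise it contributes nothing.
    by_cases hh : (1 / 2 : ℝ) ∈ B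
    · rw [indicator_of_mem (by exact hh)]
      refine ENNReal.ofReal_le_ofReal ?_
      refine (pow_mul_pow_le hz0 (by linarith) hN₀ (y := 1 / 2) (by norm_num)
        (by norm_num)).trans ?_
      refine mul_le_mul_of_nonneg_left (Real.exp_le_exp.2 (neg_le_neg ?_)) hGpos.le
      have h1 := mul_le_mul_of_nonneg_left (hBs _ hh) hN'.le
      have h2 : 0 ≤ (N₀ + N₁) * s ^ 2 := by positivity
      linarith
    · rw [indicator_of_notMem (by exact hh)]
      exact zero_le
  -- The evidence is bounded below by the slab alone. This is where the division by p and the factor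
  -- √N in front of the spike come from.
  have hden : ENNReal.ofReal (p * (b * G / √(N₀ + N₁))) ≤ ∫⁻ y, g y ∂(splitLaw a p) := by
    rw [splitLaw, lintegral_add_measure, lintegral_smul_measure, lintegral_smul_measure,
      ENNReal.ofReal_mul hp.le]
    refine le_add_left ?_
    rw [smul_eq_mul]
    gcongr
    refine le_of_eq_of_le (congrArg _ ?_) hlow
    rw [hbdef, hA, hG]; field_simp
  have hnum : ∫⁻ y in Subtype.val ⁻¹' B, g y ∂(splitLaw a p)
      ≤ ENNReal.ofReal ((1 - p) * (G * e) + p * (A * (G * e) * (√(4 * Real.pi) / √(N₀ + N₁)))) := by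
    rw [splitLaw, Measure.restrict_add, Measure.restrict_smul, Measure.restrict_smul,
      lintegral_add_measure, lintegral_smul_measure, lintegral_smul_measure, smul_eq_mul,
      smul_eq_mul, ENNReal.ofReal_add (by positivity) (by positivity), ENNReal.ofReal_mul hp0,
      ENNReal.ofReal_mul hp.le, ← hsqrt]
    gcongr
  refine hnum.trans (le_trans ?_ (mul_le_mul_right hden _))
  rw [← ENNReal.ofReal_mul (by positivity)]
  refine ENNReal.ofReal_le_ofReal ?_
  have hrhs : (A * √(4 * Real.pi) + 1) / b * e * (1 + (1 - p) / p * √(N₀ + N₁))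
      * (p * (b * G / √(N₀ + N₁)))
      = (G * e) * ((A * √(4 * Real.pi) + 1) * (p / √(N₀ + N₁) + (1 - p))) := by
    field_simp
  have hlhs : (1 - p) * (G * e) + p * (A * (G * e) * (√(4 * Real.pi) / √(N₀ + N₁)))
      = (G * e) * ((1 - p) + A * √(4 * Real.pi) * (p / √(N₀ + N₁))) := by
    field_simp
  rw [hrhs, hlhs]
  refine mul_le_mul_of_nonneg_left ?_ (by positivity)
  have h1 : 0 ≤ A * √(4 * Real.pi) := by positivity
  have h2 : 0 ≤ p / √(N₀ + N₁) := by positivity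
  nlinarith [mul_nonneg h1 hp0]

/-! ### Concentration of empirical frequencies -/

section Chernoff

variable {E : Type*} {mE : MeasurableSpace E} (μ : Measure E) [IsProbabilityMeasure μ] {A : Set E}

theorem exp_mul_indicator_sub (A : Set E) (t v : ℝ) (x : E) :
    Real.exp (t * (A.indicator (fun _ => (1 : ℝ)) x - v))
      = Real.exp (-(t * v)) * (1 + (Real.exp t - 1) * A.indicator (fun _ => (1 : ℝ)) x) := by
  by_cases hx : x ∈ A
  · simp only [indicator_of_mem hx, mul_one, add_sub_cancel, ← Real.exp_add]
    congr 1; ring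
  · simp [indicator_of_notMem hx]

theorem integrable_exp_mul_indicator_sub (hA : MeasurableSet A) (t v : ℝ) :
    Integrable (fun x => Real.exp (t * (A.indicator (fun _ => (1 : ℝ)) x - v))) μ := by
  simp_rw [exp_mul_indicator_sub]
  exact ((integrable_const _).add (((integrable_const _).indicator hA).const_mul _)).const_mul _

/-- Combines 1 + u ≤ exp u with exp t - 1 - t ≤ t² for |t| ≤ 1. The exponent keeps the factor P(A),
which is small for short intervals. -/
theorem integral_exp_mul_indicator_sub_le (hA : MeasurableSet A) {t : ℝ} (ht : |t| ≤ 1) :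
    ∫ x, Real.exp (t * (A.indicator (fun _ => (1 : ℝ)) x - μ.real A)) ∂μ
      ≤ Real.exp (t ^ 2 * μ.real A) := by
  simp_rw [exp_mul_indicator_sub]
  rw [integral_const_mul, integral_add (integrable_const _)
    (((integrable_const _).indicator hA).const_mul _), integral_const_mul,
    integral_indicator_const _ hA]
  simp only [integral_const, probReal_univ, smul_eq_mul, mul_one]
  have hv : 0 ≤ μ.real A := measureReal_nonneg
  have h1 : 1 + (Real.exp t - 1) * μ.real A ≤ Real.exp ((Real.exp t - 1) * μ.real A) := by
    linarith [Real.add_one_le_exp ((Real.exp t - 1) * μ.real A)]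
  have h2 := (abs_le.1 (Real.abs_exp_sub_one_sub_id_le ht)).2
  calc _ ≤ Real.exp (-(t * μ.real A)) * Real.exp ((Real.exp t - 1) * μ.real A) := by gcongr
    _ = Real.exp ((Real.exp t - 1 - t) * μ.real A) := by rw [← Real.exp_add]; congr 1; ring
    _ ≤ _ := by gcongr

variable (n : ℕ)

theorem mgf_sum_indicator_sub_le (hA : MeasurableSet A) {t : ℝ} (ht : |t| ≤ 1) :
    mgf (fun X : Fin n → E => ∑ i, (A.indicator (fun _ => (1 : ℝ)) (X i) - μ.real A))
      (Measure.pi fun _ => μ) t ≤ Real.exp (n * (t ^ 2 * μ.real A)) := by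
  simp_rw [mgf, Finset.mul_sum, Real.exp_sum]
  rw [integral_fintype_prod_eq_pow (ι := Fin n)
    (fun x => Real.exp (t * (A.indicator (fun _ => (1 : ℝ)) x - μ.real A))), Fintype.card_fin,
    Real.exp_nat_mul]
  exact pow_le_pow_left₀ (integral_nonneg fun _ => by positivity)
    (integral_exp_mul_indicator_sub_le μ hA ht) n

theorem integrable_exp_mul_sum_indicator_sub (hA : MeasurableSet A) (t v : ℝ) :
    Integrable (fun X : Fin n → E =>
      Real.exp (t * ∑ i, (A.indicator (fun _ => (1 : ℝ)) (X i) - v)))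
      (Measure.pi fun _ => μ) := by
  simp_rw [Finset.mul_sum, Real.exp_sum]
  exact Integrable.fintype_prod fun _ => integrable_exp_mul_indicator_sub μ hA t v

theorem measureReal_lt_abs_sum_indicator_sub_le (hA : MeasurableSet A) {V s : ℝ}
    (hV : μ.real A ≤ V) (hs : 0 ≤ s) (hnV : 0 < n * V) (hsV : s ≤ 2 * (n * V)) :
    (Measure.pi fun _ : Fin n => μ).real
      {X | s < |∑ i, (A.indicator (fun _ => (1 : ℝ)) (X i) - μ.real A)|}
      ≤ 2 * Real.exp (-(s ^ 2 / (4 * (n * V)))) := by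
  -- The minimiser of -ts + n t² V. The assumption `hsV` says exactly that t ≤ 1, as the bound on
  -- the moment generating function requires.
  set t : ℝ := s / (2 * (n * V)) with ht
  have ht0 : 0 ≤ t := by positivity
  have ht1 : t ≤ 1 := div_le_one_of_le₀ hsV (by positivity)
  have hexp : -(t * s) + n * (t ^ 2 * V) = -(s ^ 2 / (4 * (n * V))) := by
    have hn : (n : ℝ) ≠ 0 := left_ne_zero_of_mul hnV.ne'
    have hV0 : V ≠ 0 := right_ne_zero_of_mul hnV.ne'
    rw [ht]; field_simp; ring
  have hbound : ∀ u : ℝ, |u| ≤ 1 → u ^ 2 = t ^ 2 → Real.exp (-(t * s)) *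
      mgf (fun X : Fin n → E => ∑ i, (A.indicator (fun _ => (1 : ℝ)) (X i) - μ.real A))
        (Measure.pi fun _ => μ) u ≤ Real.exp (-(s ^ 2 / (4 * (n * V)))) := by
    intro u hu hut
    rw [← hexp, Real.exp_add]
    gcongr
    refine (mgf_sum_indicator_sub_le μ n hA hu).trans ?_
    rw [hut]
    gcongr
  have hup := measure_ge_le_exp_mul_mgf s ht0
    (integrable_exp_mul_sum_indicator_sub μ n hA t (μ.real A))
  have hlo := measure_le_le_exp_mul_mgf (-s) (neg_nonpos.2 ht0)
    (integrable_exp_mul_sum_indicator_sub μ n hA (-t) (μ.real A))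
  have hsub : {X : Fin n → E | s < |∑ i, (A.indicator (fun _ => (1 : ℝ)) (X i) - μ.real A)|}
      ⊆ {X | s ≤ ∑ i, (A.indicator (fun _ => (1 : ℝ)) (X i) - μ.real A)}
        ∪ {X | ∑ i, (A.indicator (fun _ => (1 : ℝ)) (X i) - μ.real A) ≤ -s} := by
    intro X hX
    rcases lt_abs.1 (show s < |_| from hX) with h | h
    · exact Or.inl h.le
    · exact Or.inr (by simp only [mem_ofPred_eq]; linarith)
  refine (measureReal_mono hsub).trans ((measureReal_union_le _ _).trans ?_)
  rw [two_mul]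
  refine add_le_add (hup.trans ?_) (hlo.trans ?_)
  · rw [neg_mul]
    exact hbound t (by rwa [abs_of_nonneg ht0]) rfl
  · rw [neg_neg, mul_neg]
    exact hbound (-t) (by rwa [abs_neg, abs_of_nonneg ht0]) (neg_sq t)

end Chernoff

/-- A union bound over the tree: 2^l nodes of probability q^(l+1) form a geometric series of ratio
2q ≤ 1/2. It serves both for the counts and for the splitting variables. -/
theorem sum_two_pow_mul_pow_le {q : ℝ} (hq : 0 ≤ q) (hq1 : q ≤ 1 / 4) (m : ℕ) :
    ∑ l ∈ Finset.range m, (2 : ℝ) ^ l * q ^ (l + 1) ≤ 2 * q := by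
  have h : ∀ l, (2 : ℝ) ^ l * q ^ (l + 1) ≤ q * (1 / 2) ^ l := by
    intro l
    have : (2 : ℝ) ^ l * q ^ (l + 1) = q * (2 * q) ^ l := by rw [mul_pow]; ring
    rw [this]
    gcongr
    linarith
  calc _ ≤ ∑ l ∈ Finset.range m, q * (1 / 2 : ℝ) ^ l := Finset.sum_le_sum fun l _ => h l
    _ = q * ∑ l ∈ Finset.range m, (1 / 2 : ℝ) ^ l := by rw [Finset.mul_sum]
    _ ≤ q * 2 := by
      gcongr
      exact sum_geometric_two_le m
    _ = _ := mul_comm _ _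

/-! ### Sampling from a density of the class -/

/-- The mass that a density `f` gives to the dyadic interval `(l, k)`. -/
def dyadicMass (f : ℝ → ℝ) (l k : ℕ) : ℝ := ∫ x in dyadic l k, f x

theorem dyadic_subset {l k : ℕ} (hk : k < 2 ^ l) : dyadic l k ⊆ Ioc 0 1 := by
  intro x hx
  have hk' : (k : ℝ) + 1 ≤ 2 ^ l := by exact_mod_cast hk
  exact ⟨lt_of_le_of_lt (by positivity) hx.1,
    hx.2.trans ((div_le_one (by positivity)).2 hk')⟩

theorem measureReal_dyadic (l k : ℕ) : volume.real (dyadic l k) = 1 / 2 ^ l := by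
  rw [dyadic, Real.volume_real_Ioc_of_le (by gcongr; simp)]
  ring

theorem measure_dyadic_lt_top (l k : ℕ) : volume (dyadic l k) < ∞ := by
  rw [dyadic]; exact measure_Ioc_lt_top

theorem disjoint_dyadic_children (l k : ℕ) :
    Disjoint (dyadic (l + 1) (2 * k)) (dyadic (l + 1) (2 * k + 1)) := by
  rw [Set.disjoint_left]
  intro x hx hx'
  have h := hx.2
  have h' := hx'.1
  push_cast at h h'
  linarith

theorem dyadicMass_children {f : ℝ → ℝ} (hf : IntegrableOn f (Icc 0 1)) {l k : ℕ}
    (hk : k < 2 ^ l) :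
    dyadicMass f (l + 1) (2 * k) + dyadicMass f (l + 1) (2 * k + 1) = dyadicMass f l k := by
  have hint : IntegrableOn f (dyadic l k) :=
    hf.mono_set ((dyadic_subset hk).trans Ioc_subset_Icc_self)
  unfold dyadicMass
  conv_rhs => rw [dyadic_eq_union_children]
  rw [dyadic_eq_union_children] at hint
  rw [setIntegral_union (disjoint_dyadic_children l k) (measurableSet_dyadic _ _)
    (hint.mono_set subset_union_left) (hint.mono_set subset_union_right)]

variable {m₀ m₁ : ℝ} {f : ℝ → ℝ}

theorem one_le_of_mem_densityClass (hf : f ∈ densityClass m₀ m₁) : m₀ ≤ 1 ∧ 1 ≤ m₁ := by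
  obtain ⟨hint, h1, hb⟩ := hf
  have hc : ∀ c : ℝ, ∫ _ in Icc (0 : ℝ) 1, c = c := by intro c; simp
  constructor
  · rw [← h1, ← hc m₀]
    exact integral_mono_ae (integrable_const _) hint (hb.mono fun x hx => hx.1)
  · rw [← h1, ← hc m₁]
    exact integral_mono_ae hint (integrable_const _) (hb.mono fun x hx => hx.2)

theorem ae_dyadic_bounds (hf : f ∈ densityClass m₀ m₁) {l k : ℕ} (hk : k < 2 ^ l) :
    ∀ᵐ x ∂(volume.restrict (dyadic l k)), m₀ ≤ f x ∧ f x ≤ m₁ :=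
  ae_restrict_of_ae_restrict_of_subset ((dyadic_subset hk).trans Ioc_subset_Icc_self) hf.2.2

theorem dyadicMass_bounds (hf : f ∈ densityClass m₀ m₁) {l k : ℕ} (hk : k < 2 ^ l) :
    m₀ / 2 ^ l ≤ dyadicMass f l k ∧ dyadicMass f l k ≤ m₁ / 2 ^ l := by
  have hint : IntegrableOn f (dyadic l k) :=
    hf.1.mono_set ((dyadic_subset hk).trans Ioc_subset_Icc_self)
  have hfin : IsFiniteMeasure (volume.restrict (dyadic l k)) :=
    ⟨by simpa using measure_dyadic_lt_top l k⟩
  have hc : ∀ c : ℝ, ∫ _ in dyadic l k, c = c / 2 ^ l := by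
    intro c
    rw [setIntegral_const, measureReal_dyadic, smul_eq_mul]; ring
  constructor
  · rw [← hc m₀]
    exact integral_mono_ae (integrable_const _) hint
      ((ae_dyadic_bounds hf hk).mono fun x hx => hx.1)
  · rw [← hc m₁]
    exact integral_mono_ae hint (integrable_const _)
      ((ae_dyadic_bounds hf hk).mono fun x hx => hx.2)

theorem isProbabilityMeasure_densityMeasure (hm₀ : 0 ≤ m₀) (hf : f ∈ densityClass m₀ m₁) :
    IsProbabilityMeasure (densityMeasure f) := by
  constructor
  rw [densityMeasure, withDensity_apply _ MeasurableSet.univ, Measure.restrict_univ,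
    ← ofReal_integral_eq_lintegral_ofReal hf.1 (hf.2.2.mono fun x hx => hm₀.trans hx.1), hf.2.1,
    ENNReal.ofReal_one]

theorem measureReal_dyadicIndex_eq (hm₀ : 0 ≤ m₀) (hf : f ∈ densityClass m₀ m₁) {l k : ℕ}
    (hk : k < 2 ^ l) :
    (densityMeasure f).real {x | dyadicIndex l x = k} = dyadicMass f l k := by
  have hS : MeasurableSet {x | dyadicIndex l x = k} :=
    measurable_dyadicIndex l (measurableSet_singleton k)
  have hae : (Icc (0 : ℝ) 1 ∩ {x | dyadicIndex l x = k} : Set ℝ) =ᵐ[volume] dyadic l k := by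
    have h1 : (Icc (0 : ℝ) 1 ∩ {x | dyadicIndex l x = k} : Set ℝ)
        =ᵐ[volume] (Ioc (0 : ℝ) 1 ∩ {x | dyadicIndex l x = k} : Set ℝ) :=
      ae_eq_set_inter Ioc_ae_eq_Icc.symm (ae_eq_refl _)
    refine h1.trans (Eq.eventuallyEq ?_)
    ext x
    constructor
    · exact fun hx => (mem_dyadic_iff hx.1.1).2 hx.2
    · exact fun hx => ⟨dyadic_subset hk hx, (mem_dyadic_iff (dyadic_subset hk hx).1).1 hx⟩
  rw [Measure.real, densityMeasure, withDensity_apply _ hS, Measure.restrict_restrict hS,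
    inter_comm, setLIntegral_congr hae, dyadicMass, integral_eq_lintegral_of_nonneg_ae
      ((ae_dyadic_bounds hf hk).mono fun x hx => hm₀.trans hx.1)
      (hf.1.mono_set ((dyadic_subset hk).trans Ioc_subset_Icc_self)).aestronglyMeasurable]

/-- Transfers Bayes' formula, known for Lebesgue-almost every sample, to samples drawn from the
truth. As f is only almost everywhere measurable, a measurable version of its density replaces it.
-/
theorem sampleLaw_absolutelyContinuous (n : ℕ) (hm₀ : 0 ≤ m₀) (hf : f ∈ densityClass m₀ m₁) :
    sampleLaw n f ≪ Measure.pi fun _ : Fin n => unitVolume := by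
  have hprob := isProbabilityMeasure_densityMeasure hm₀ hf
  have haem : AEMeasurable (fun x => ENNReal.ofReal (f x)) unitVolume :=
    hf.1.aestronglyMeasurable.aemeasurable.ennreal_ofReal
  obtain ⟨g, hg, hfg⟩ := haem
  have heq : densityMeasure f = unitVolume.withDensity g := withDensity_congr_ae hfg
  have hs : SigmaFinite (unitVolume.withDensity g) := by
    rw [← heq]; infer_instance
  have hpi : Measure.pi (fun _ : Fin n => unitVolume.withDensity g) = _ :=
    pi_withDensity (fun _ : Fin n => g) fun _ => hg
  rw [sampleLaw, heq, hpi]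
  exact withDensity_absolutelyContinuous _ _

theorem sum_indicator_eq_count {n : ℕ} (X : Fin n → ℝ) (l k : ℕ) (v : ℝ) :
    ∑ i, ({x | dyadicIndex l x = k}.indicator (fun _ => (1 : ℝ)) (X i) - v)
      = count X l k - n * v := by
  rw [Finset.sum_sub_distrib, Finset.sum_const, Finset.card_univ, Fintype.card_fin, nsmul_eq_mul,
    count, Finset.card_filter]
  simp [indicator_apply]

/-- The samples for which the number of observations in some dyadic interval of level at most `L`
deviates from its mean. -/
def badSamples (n L : ℕ) (f : ℝ → ℝ) (K : ℝ) : Set (Fin n → ℝ) :=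
  {X | ∃ l ≤ L, ∃ k < 2 ^ l, K * √(n / 2 ^ l * (l + 1)) < |count X l k - n * dyadicMass f l k|}

/-- The factor l + 1 under the root turns the Chernoff tail at level l into 2q^(l+1), with q the
exponential in `hq`, which outweighs the 2^l intervals of that level. -/
theorem sampleLaw_badSamples_le {n L : ℕ} (hn : 0 < n) (hm₀ : 0 ≤ m₀)
    (hf : f ∈ densityClass m₀ m₁) {K : ℝ} (hK : 0 ≤ K)
    (hq : Real.exp (-(K ^ 2 / (4 * m₁))) ≤ 1 / 4)
    (hs : ∀ l ≤ L, K * √(n / 2 ^ l * (l + 1)) ≤ 2 * (n * (m₁ / 2 ^ l))) :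
    sampleLaw n f (badSamples n L f K)
      ≤ ENNReal.ofReal (4 * Real.exp (-(K ^ 2 / (4 * m₁)))) := by
  have hprob := isProbabilityMeasure_densityMeasure hm₀ hf
  have hm₁ : 0 < m₁ := by linarith [(one_le_of_mem_densityClass hf).2]
  have hn' : (0 : ℝ) < n := by exact_mod_cast hn
  set q := Real.exp (-(K ^ 2 / (4 * m₁))) with hqdef
  set S : ℕ → ℕ → Set (Fin n → ℝ) := fun l k =>
    {X | K * √(n / 2 ^ l * (l + 1)) < |count X l k - n * dyadicMass f l k|} with hSdef
  have hsub : badSamples n L f K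
      ⊆ ⋃ l ∈ Finset.range (L + 1), ⋃ k ∈ Finset.range (2 ^ l), S l k := by
    rintro X ⟨l, hl, k, hk, h⟩
    simp only [mem_iUnion, Finset.mem_range]
    exact ⟨l, by omega, k, hk, h⟩
  have hone : ∀ l ≤ L, ∀ k < 2 ^ l, sampleLaw n f (S l k) ≤ ENNReal.ofReal (2 * q ^ (l + 1)) := by
    intro l hl k hk
    have hS : MeasurableSet {x | dyadicIndex l x = k} :=
      measurable_dyadicIndex l (measurableSet_singleton k)
    have hreal := measureReal_dyadicIndex_eq hm₀ hf hk
    have h := measureReal_lt_abs_sum_indicator_sub_le (densityMeasure f) n hS (V := m₁ / 2 ^ l)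
      (s := K * √(n / 2 ^ l * (l + 1))) (by rw [hreal]; exact (dyadicMass_bounds hf hk).2)
      (by positivity) (by positivity) (hs l hl)
    simp_rw [sum_indicator_eq_count, hreal] at h
    have hexp : Real.exp (-((K * √(n / 2 ^ l * (l + 1))) ^ 2 / (4 * (n * (m₁ / 2 ^ l)))))
        = q ^ (l + 1) := by
      rw [hqdef, ← Real.exp_nat_mul, mul_pow, Real.sq_sqrt (by positivity)]
      congr 1
      push_cast
      field_simp
    rw [hexp] at h
    have : IsProbabilityMeasure (sampleLaw n f) := by unfold sampleLaw; infer_instance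
    rw [← ofReal_measureReal (measure_ne_top _ _)]
    exact ENNReal.ofReal_le_ofReal h
  calc _ ≤ ∑ l ∈ Finset.range (L + 1), ∑ k ∈ Finset.range (2 ^ l), sampleLaw n f (S l k) :=
        (measure_mono hsub).trans ((measure_biUnion_finset_le _ _).trans
          (Finset.sum_le_sum fun l _ => measure_biUnion_finset_le _ _))
    _ ≤ ∑ l ∈ Finset.range (L + 1), ∑ k ∈ Finset.range (2 ^ l),
          ENNReal.ofReal (2 * q ^ (l + 1)) :=
        Finset.sum_le_sum fun l hl => Finset.sum_le_sum fun k hk =>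
          hone l (by have := Finset.mem_range.1 hl; omega) k (Finset.mem_range.1 hk)
    _ = ENNReal.ofReal (∑ l ∈ Finset.range (L + 1), 2 * (2 ^ l * q ^ (l + 1))) := by
        rw [ENNReal.ofReal_sum_of_nonneg fun l _ => by positivity]
        refine Finset.sum_congr rfl fun l _ => ?_
        rw [Finset.sum_const, Finset.card_range, nsmul_eq_mul]
        rw [← ENNReal.ofReal_natCast, ← ENNReal.ofReal_mul (by positivity)]
        congr 1
        push_cast
        ring
    _ ≤ _ := by
        refine ENNReal.ofReal_le_ofReal ?_
        rw [← Finset.mul_sum]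
        linarith [sum_two_pow_mul_pow_le (Real.exp_pos _).le hq (L + 1)]

/-! ### Haar coefficients and tree masses -/

theorem haar_eq_indicator (l k : ℕ) (x : ℝ) :
    haar l k x = (2 : ℝ) ^ ((l : ℝ) / 2)
      * ((dyadic (l + 1) (2 * k + 1)).indicator (fun _ => (1 : ℝ)) x
        - (dyadic (l + 1) (2 * k)).indicator (fun _ => (1 : ℝ)) x) := by
  have h2 : (0 : ℝ) < 2 ^ (l + 1) := by positivity
  have hr : ((2 : ℝ) ^ l * x - k ∈ Ioc (1 / 2 : ℝ) 1) ↔ x ∈ dyadic (l + 1) (2 * k + 1) := by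
    rw [dyadic, mem_Ioc, mem_Ioc, div_lt_iff₀ h2, le_div_iff₀ h2, pow_succ]
    push_cast
    constructor <;> rintro ⟨h, h'⟩ <;> constructor <;> linarith
  have hl : ((2 : ℝ) ^ l * x - k ∈ Ioc (0 : ℝ) (1 / 2)) ↔ x ∈ dyadic (l + 1) (2 * k) := by
    rw [dyadic, mem_Ioc, mem_Ioc, div_lt_iff₀ h2, le_div_iff₀ h2, pow_succ]
    push_cast
    constructor <;> rintro ⟨h, h'⟩ <;> constructor <;> linarith
  have key : ∀ {s t : Set ℝ} {u : ℝ}, (u ∈ s ↔ x ∈ t) →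
      s.indicator (fun _ => (1 : ℝ)) u = t.indicator (fun _ => (1 : ℝ)) x := by
    intro s t u h
    by_cases hx : x ∈ t
    · rw [indicator_of_mem hx, indicator_of_mem (h.2 hx)]
    · rw [indicator_of_notMem hx, indicator_of_notMem fun hu => hx (h.1 hu)]
  rw [haar, haarMother, key hr, key hl]

theorem setIntegral_mul_indicator_dyadic (g : ℝ → ℝ) {l k : ℕ} (hk : k < 2 ^ l) :
    ∫ x in Icc (0 : ℝ) 1, g x * (dyadic l k).indicator (fun _ => (1 : ℝ)) x = dyadicMass g l k := by
  have h : (fun x => g x * (dyadic l k).indicator (fun _ => (1 : ℝ)) x)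
      = (dyadic l k).indicator g := by
    ext x
    by_cases hx : x ∈ dyadic l k <;> simp [hx]
  rw [h, setIntegral_indicator (measurableSet_dyadic l k), dyadicMass,
    inter_eq_right.2 ((dyadic_subset hk).trans Ioc_subset_Icc_self)]

theorem haarCoeff_eq {g : ℝ → ℝ} (hg : IntegrableOn g (Icc 0 1)) {l k : ℕ} (hk : k < 2 ^ l) :
    haarCoeff g l k = (2 : ℝ) ^ ((l : ℝ) / 2)
      * (dyadicMass g (l + 1) (2 * k + 1) - dyadicMass g (l + 1) (2 * k)) := by
  have hk0 : 2 * k < 2 ^ (l + 1) := by rw [pow_succ]; omega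
  have hk1 : 2 * k + 1 < 2 ^ (l + 1) := by rw [pow_succ]; omega
  have hint : ∀ j, IntegrableOn
      (fun x => g x * (dyadic (l + 1) j).indicator (fun _ => (1 : ℝ)) x) (Icc 0 1) := by
    intro j
    refine (hg.indicator (measurableSet_dyadic (l + 1) j)).congr (ae_of_all _ fun x => ?_)
    by_cases hx : x ∈ dyadic (l + 1) j <;> simp [hx]
  unfold haarCoeff
  simp_rw [haar_eq_indicator, mul_left_comm (g _), mul_sub]
  rw [integral_sub ((hint _).const_mul _) ((hint _).const_mul _), integral_const_mul,
    integral_const_mul, setIntegral_mul_indicator_dyadic g hk1,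
    setIntegral_mul_indicator_dyadic g hk0]

theorem dyadicIndex_div_two_pow (l d : ℕ) {x : ℝ} (hx : 0 < x) :
    dyadicIndex (l + d) x / 2 ^ d = dyadicIndex l x := by
  induction d with
  | zero => simp
  | succ d ih =>
    rw [pow_succ, mul_comm, ← Nat.div_div_eq_div_mul, ← add_assoc, dyadicIndex_succ_div _ hx, ih]

theorem integrableOn_treeDensity {L : ℕ} (Y : Splits L) :
    IntegrableOn (treeDensity L Y) (Icc 0 1) := by
  unfold treeDensity
  exact integrable_finsetSum _ fun k _ =>
    (integrable_const _).indicator (measurableSet_dyadic L k)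

theorem dyadicMass_treeDensity_add {L : ℕ} (Y : Splits L) {d k : ℕ} (hk : k < 2 ^ (L + d)) :
    dyadicMass (treeDensity L Y) (L + d) k
      = 2 ^ L * treeMass (splitAt Y) L (k / 2 ^ d) / 2 ^ (L + d) := by
  have h : ∀ x ∈ dyadic (L + d) k,
      treeDensity L Y x = 2 ^ L * treeMass (splitAt Y) L (k / 2 ^ d) := by
    intro x hx
    have hx' := dyadic_subset hk hx
    rw [treeDensity_apply Y hx', ← dyadicIndex_div_two_pow L d hx'.1, (mem_dyadic_iff hx'.1).1 hx]
  rw [dyadicMass, setIntegral_congr_fun (measurableSet_dyadic _ _) h, setIntegral_const,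
    measureReal_dyadic, smul_eq_mul]
  ring

theorem treeMass_left (y : ℕ → ℕ → ℝ) (l k : ℕ) :
    treeMass y (l + 1) (2 * k) = treeMass y l k * y l k := by
  have h1 : (2 * k) / 2 = k := by omega
  have h3 : (2 * k) % 2 = 0 := by omega
  rw [treeMass, h1, if_pos h3]

theorem treeMass_right (y : ℕ → ℕ → ℝ) (l k : ℕ) :
    treeMass y (l + 1) (2 * k + 1) = treeMass y l k * (1 - y l k) := by
  have h1 : (2 * k + 1) / 2 = k := by omega
  have h3 : (2 * k + 1) % 2 ≠ 0 := by omega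
  rw [treeMass, h1, if_neg h3]

/-- Induction from the leaves upwards, on L - l: the masses of the children add up on both sides. -/
theorem dyadicMass_treeDensity {L : ℕ} (Y : Splits L) {l k : ℕ} (hl : l ≤ L) (hk : k < 2 ^ l) :
    dyadicMass (treeDensity L Y) l k = treeMass (splitAt Y) l k := by
  obtain ⟨d, hd⟩ := Nat.exists_eq_add_of_le hl
  induction d generalizing l k with
  | zero =>
    obtain rfl : L = l := hd
    have h := dyadicMass_treeDensity_add Y (d := 0) (k := k) hk
    simp only [add_zero, pow_zero, Nat.div_one] at h
    rw [h]
    field_simp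
  | succ d ih =>
    have hk0 : 2 * k < 2 ^ (l + 1) := by rw [pow_succ]; omega
    have hk1 : 2 * k + 1 < 2 ^ (l + 1) := by rw [pow_succ]; omega
    rw [← dyadicMass_children (integrableOn_treeDensity Y) hk,
      ih (by omega) hk0 (by omega), ih (by omega) hk1 (by omega), treeMass_left,
      treeMass_right]
    ring

/-- A wavelet of level l ≥ L lives inside one leaf, where the histogram is constant, so only the
bias remains. -/
theorem haarCoeff_treeDensity_sub_of_le {L : ℕ} (Y : Splits L) {f : ℝ → ℝ}
    (hf : IntegrableOn f (Icc 0 1)) {l k : ℕ} (hl : L ≤ l) (hk : k < 2 ^ l) :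
    haarCoeff (fun x => treeDensity L Y x - f x) l k = -haarCoeff f l k := by
  have hk0 : 2 * k < 2 ^ (l + 1) := by rw [pow_succ]; omega
  have hk1 : 2 * k + 1 < 2 ^ (l + 1) := by rw [pow_succ]; omega
  have htree : haarCoeff (treeDensity L Y) l k = 0 := by
    obtain ⟨d, rfl⟩ := Nat.exists_eq_add_of_le hl
    have hdiv : ∀ j, j / 2 ^ (d + 1) = j / 2 / 2 ^ d := fun j => by
      rw [pow_succ, mul_comm, Nat.div_div_eq_div_mul]
    have h0 : 2 * k / 2 = k := by omega
    have h1 : (2 * k + 1) / 2 = k := by omega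
    rw [haarCoeff_eq (integrableOn_treeDensity Y) hk, add_assoc,
      dyadicMass_treeDensity_add Y (d := d + 1) hk0,
      dyadicMass_treeDensity_add Y (d := d + 1) hk1, hdiv, hdiv, h0, h1,
      sub_self, mul_zero]
  have hsub : ∀ j, j < 2 ^ (l + 1) → dyadicMass (fun x => treeDensity L Y x - f x) (l + 1) j
      = dyadicMass (treeDensity L Y) (l + 1) j - dyadicMass f (l + 1) j := fun j hj =>
    integral_sub
      ((integrableOn_treeDensity Y).mono_set ((dyadic_subset hj).trans Ioc_subset_Icc_self))
      (hf.mono_set ((dyadic_subset hj).trans Ioc_subset_Icc_self))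
  have hint : IntegrableOn (fun x => treeDensity L Y x - f x) (Icc 0 1) :=
    (integrableOn_treeDensity Y).sub hf
  rw [haarCoeff_eq hint hk, hsub _ hk0, hsub _ hk1,
    haarCoeff_eq hf hk]
  rw [haarCoeff_eq (integrableOn_treeDensity Y) hk] at htree
  linear_combination htree

theorem haarCoeff_treeDensity_sub_of_lt {L : ℕ} (Y : Splits L) {f : ℝ → ℝ}
    (hf : IntegrableOn f (Icc 0 1)) {l k : ℕ} (hl : l < L) (hk : k < 2 ^ l) :
    haarCoeff (fun x => treeDensity L Y x - f x) l k = (2 : ℝ) ^ ((l : ℝ) / 2)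
      * ((treeMass (splitAt Y) (l + 1) (2 * k + 1) - dyadicMass f (l + 1) (2 * k + 1))
        - (treeMass (splitAt Y) (l + 1) (2 * k) - dyadicMass f (l + 1) (2 * k))) := by
  have hk0 : 2 * k < 2 ^ (l + 1) := by rw [pow_succ]; omega
  have hk1 : 2 * k + 1 < 2 ^ (l + 1) := by rw [pow_succ]; omega
  have hsub : ∀ j, j < 2 ^ (l + 1) → dyadicMass (fun x => treeDensity L Y x - f x) (l + 1) j
      = treeMass (splitAt Y) (l + 1) j - dyadicMass f (l + 1) j := fun j hj => by
    rw [← dyadicMass_treeDensity Y hl hj]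
    exact integral_sub
      ((integrableOn_treeDensity Y).mono_set ((dyadic_subset hj).trans Ioc_subset_Icc_self))
      (hf.mono_set ((dyadic_subset hj).trans Ioc_subset_Icc_self))
  have hint : IntegrableOn (fun x => treeDensity L Y x - f x) (Icc 0 1) :=
    (integrableOn_treeDensity Y).sub hf
  rw [haarCoeff_eq hint hk, hsub _ hk0, hsub _ hk1]

/-! ### Propagation of errors in the splitting variables along the tree -/

/-- The proportion of the mass of the node `(l, k)` that the density `f` gives to the left child. -/
def trueSplit (f : ℝ → ℝ) (l k : ℕ) : ℝ := dyadicMass f (l + 1) (2 * k) / dyadicMass f l k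

/-- One step down the tree: a relative error 4q of the parent and q of the split combine to q(4(1+q)
+ 1), at most 27q/5 when q ≤ 1/10. -/
theorem abs_mul_sub_mul_le {T M y z δ q : ℝ} (hy : 0 ≤ y) (hM : 0 ≤ M) (hδ : δ ≤ z)
    (hz : 0 ≤ z) (hq : 0 ≤ q) (hq1 : q ≤ 1 / 10) (hT : |T - M| ≤ M * (4 * q))
    (hyz : |y - z| ≤ δ * q) : |T * y - M * z| ≤ M * z * (27 / 5 * q) := by
  have hyle : y ≤ z * (1 + q) := by nlinarith [(abs_le.1 hyz).2]
  have hyz' : |y - z| ≤ z * q := hyz.trans (by gcongr)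
  calc |T * y - M * z| = |(T - M) * y + M * (y - z)| := by congr 1; ring
    _ ≤ |(T - M) * y| + |M * (y - z)| := abs_add_le _ _
    _ = |T - M| * y + M * |y - z| := by rw [abs_mul, abs_mul, abs_of_nonneg hy, abs_of_nonneg hM]
    _ ≤ M * (4 * q) * (z * (1 + q)) + M * (z * q) := by gcongr
    _ = M * z * (q * (4 * (1 + q) + 1)) := by ring
    _ ≤ M * z * (q * (27 / 5)) := by gcongr; linarith
    _ = _ := by ring

theorem dyadicMass_pos (hm₀ : 0 < m₀) (hf : f ∈ densityClass m₀ m₁) {l k : ℕ} (hk : k < 2 ^ l) :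
    0 < dyadicMass f l k :=
  lt_of_lt_of_le (by positivity) (dyadicMass_bounds hf hk).1

/-- A child has mass at least m₀/2^(l+1) and its parent at most m₁/2^l. The bounds turn absolute
errors of splits into relative ones and keep the Beta density away from its zeros. -/
theorem trueSplit_bounds (hm₀ : 0 < m₀) (hf : f ∈ densityClass m₀ m₁) {l k : ℕ}
    (hk : k < 2 ^ l) :
    m₀ / (2 * m₁) ≤ trueSplit f l k ∧ trueSplit f l k ≤ 1 - m₀ / (2 * m₁) := by
  have hm₁ : 0 < m₁ := by linarith [(one_le_of_mem_densityClass hf).2]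
  have hk0 : 2 * k < 2 ^ (l + 1) := by rw [pow_succ]; omega
  have hk1 : 2 * k + 1 < 2 ^ (l + 1) := by rw [pow_succ]; omega
  have hM := dyadicMass_pos hm₀ hf hk
  have key : ∀ v, m₀ / 2 ^ (l + 1) ≤ v → m₀ / (2 * m₁) ≤ v / dyadicMass f l k := by
    intro v hv
    rw [le_div_iff₀ hM]
    refine le_trans ?_ hv
    calc m₀ / (2 * m₁) * dyadicMass f l k ≤ m₀ / (2 * m₁) * (m₁ / 2 ^ l) := by
          gcongr
          exact (dyadicMass_bounds hf hk).2
      _ = m₀ / 2 ^ (l + 1) := by rw [pow_succ]; field_simp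
  refine ⟨key _ (dyadicMass_bounds hf hk0).1, ?_⟩
  have h1 := key _ (dyadicMass_bounds hf hk1).1
  have h2 : dyadicMass f (l + 1) (2 * k + 1) / dyadicMass f l k = 1 - trueSplit f l k := by
    rw [trueSplit, eq_sub_iff_add_eq, ← add_div, div_eq_one_iff_eq hM.ne', add_comm,
      dyadicMass_children hf.1 hk]
  linarith

theorem dyadicMass_left (hm₀ : 0 < m₀) (hf : f ∈ densityClass m₀ m₁) {l k : ℕ} (hk : k < 2 ^ l) :
    dyadicMass f (l + 1) (2 * k) = dyadicMass f l k * trueSplit f l k := by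
  rw [trueSplit, mul_div_cancel₀ _ (dyadicMass_pos hm₀ hf hk).ne']

theorem dyadicMass_right (hm₀ : 0 < m₀) (hf : f ∈ densityClass m₀ m₁) {l k : ℕ} (hk : k < 2 ^ l) :
    dyadicMass f (l + 1) (2 * k + 1) = dyadicMass f l k * (1 - trueSplit f l k) := by
  linarith [dyadicMass_left hm₀ hf hk, dyadicMass_children hf.1 hk]

theorem treeMass_sub_children_le (hm₀ : 0 < m₀) (hf : f ∈ densityClass m₀ m₁) {L : ℕ}
    {Y : Splits L} {q : ℝ} (hq : 0 ≤ q) (hq1 : q ≤ 1 / 10) {l k : ℕ} (hk : k < 2 ^ l)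
    (hY : |splitAt Y l k - trueSplit f l k| ≤ m₀ / (2 * m₁) * q)
    (hT : |treeMass (splitAt Y) l k - dyadicMass f l k| ≤ dyadicMass f l k * (4 * q)) :
    |treeMass (splitAt Y) (l + 1) (2 * k) - dyadicMass f (l + 1) (2 * k)|
        ≤ dyadicMass f (l + 1) (2 * k) * (27 / 5 * q) ∧
      |treeMass (splitAt Y) (l + 1) (2 * k + 1) - dyadicMass f (l + 1) (2 * k + 1)|
        ≤ dyadicMass f (l + 1) (2 * k + 1) * (27 / 5 * q) := by
  have hm₁ : 0 < m₁ := by linarith [(one_le_of_mem_densityClass hf).2]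
  have hδ : 0 < m₀ / (2 * m₁) := by positivity
  obtain ⟨h1, h2⟩ := trueSplit_bounds hm₀ hf hk
  obtain ⟨h3, h4⟩ := splitAt_mem Y l k
  have hM := (dyadicMass_pos hm₀ hf hk).le
  rw [treeMass_left, treeMass_right, dyadicMass_left hm₀ hf hk, dyadicMass_right hm₀ hf hk]
  refine ⟨abs_mul_sub_mul_le h3 hM h1 (by linarith) hq hq1 hT hY,
    abs_mul_sub_mul_le (δ := m₀ / (2 * m₁)) (by linarith) hM (by linarith) (by linarith) hq hq1 hT ?_⟩
  rw [sub_sub_sub_cancel_left, abs_sub_comm]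
  exact hY

/-- Errors do not pile up with depth: by `hgrow`, the allowance 4q of the next level covers
everything inherited from above. -/
theorem treeMass_sub_le (hm₀ : 0 < m₀) (hf : f ∈ densityClass m₀ m₁) {L : ℕ} {Y : Splits L}
    {q : ℕ → ℝ} (hq : ∀ l, 0 ≤ q l) (hq1 : ∀ l < L, q l ≤ 1 / 10)
    (hgrow : ∀ l, l + 1 < L → 27 / 5 * q l ≤ 4 * q (l + 1))
    (hY : ∀ l < L, ∀ k < 2 ^ l, |splitAt Y l k - trueSplit f l k| ≤ m₀ / (2 * m₁) * q l)
    {l : ℕ} (hl : l < L) {k : ℕ} (hk : k < 2 ^ l) :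
    |treeMass (splitAt Y) l k - dyadicMass f l k| ≤ dyadicMass f l k * (4 * q l) := by
  induction l generalizing k with
  | zero =>
    have h0 : dyadicMass f 0 0 = 1 := by
      rw [← hf.2.1, integral_Icc_eq_integral_Ioc]
      simp [dyadicMass, dyadic]
    obtain rfl : k = 0 := by simpa using hk
    simp only [treeMass, h0, sub_self, abs_zero, one_mul]
    linarith [hq 0]
  | succ l ih =>
    have hkl : k / 2 < 2 ^ l := by rw [pow_succ] at hk; omega
    obtain ⟨h0, h1⟩ := treeMass_sub_children_le hm₀ hf (hq l) (hq1 l (by omega)) hkl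
      (hY l (by omega) _ hkl) (ih (by omega) hkl)
    have hM := (dyadicMass_pos hm₀ hf hk).le
    have hstep : |treeMass (splitAt Y) (l + 1) k - dyadicMass f (l + 1) k|
        ≤ dyadicMass f (l + 1) k * (27 / 5 * q l) := by
      rcases Nat.even_or_odd' k with ⟨j, rfl | rfl⟩
      · rwa [show 2 * j / 2 = j by omega] at h0
      · rwa [show (2 * j + 1) / 2 = j by omega] at h1
    exact hstep.trans (mul_le_mul_of_nonneg_left (hgrow l hl) hM)

theorem abs_haarCoeff_treeDensity_sub_le (hm₀ : 0 < m₀) (hf : f ∈ densityClass m₀ m₁) {L : ℕ}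
    {Y : Splits L} {q : ℕ → ℝ} (hq : ∀ l, 0 ≤ q l) (hq1 : ∀ l < L, q l ≤ 1 / 10)
    (hgrow : ∀ l, l + 1 < L → 27 / 5 * q l ≤ 4 * q (l + 1))
    (hY : ∀ l < L, ∀ k < 2 ^ l, |splitAt Y l k - trueSplit f l k| ≤ m₀ / (2 * m₁) * q l)
    {l : ℕ} (hl : l < L) {k : ℕ} (hk : k < 2 ^ l) :
    |haarCoeff (fun x => treeDensity L Y x - f x) l k| ≤ 6 * m₁ * (q l / √(2 ^ l)) := by
  obtain ⟨h0, h1⟩ := treeMass_sub_children_le hm₀ hf (hq l) (hq1 l hl) hk (hY l hl k hk)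
    (treeMass_sub_le hm₀ hf hq hq1 hgrow hY hl hk)
  have hpow : (2 : ℝ) ^ ((l : ℝ) / 2) = √(2 ^ l) := by
    rw [Real.sqrt_eq_rpow, ← Real.rpow_natCast, ← Real.rpow_mul (by norm_num)]
    congr 1; ring
  have hsq : (0 : ℝ) < √(2 ^ l) := by positivity
  have hM := (dyadicMass_bounds hf hk).2
  have hM0 := (dyadicMass_pos hm₀ hf hk).le
  have hql := hq l
  rw [haarCoeff_treeDensity_sub_of_lt Y hf.1 hl hk, hpow, abs_mul, abs_of_pos hsq]
  calc _ ≤ √(2 ^ l) * (dyadicMass f (l + 1) (2 * k + 1) * (27 / 5 * q l)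
          + dyadicMass f (l + 1) (2 * k) * (27 / 5 * q l)) := by
        gcongr
        exact (abs_sub _ _).trans (add_le_add h1 h0)
    _ = √(2 ^ l) * (dyadicMass f l k * (27 / 5 * q l)) := by
        rw [← dyadicMass_children hf.1 hk]; ring
    -- The constant 27/5 is rounded up to 6.
    _ ≤ √(2 ^ l) * (m₁ / 2 ^ l * (6 * q l)) := by
        gcongr
        · exact hM0.trans hM
        · norm_num
    _ = _ := by
        have : (2 : ℝ) ^ l = √(2 ^ l) * √(2 ^ l) := (Real.mul_self_sqrt (by positivity)).symm
        rw [div_eq_mul_inv m₁]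
        nth_rewrite 2 [this]
        field_simp

/-! ### Posterior of one splitting variable on good samples -/

theorem deviation_scale_succ_le {K : ℝ} (hK : 0 ≤ K) (n l : ℕ) :
    K * √(n / 2 ^ (l + 1) * ((l + 1 : ℕ) + 1)) ≤ K * √(n / 2 ^ l * (l + 1)) := by
  gcongr K * √?_
  have h : (n : ℝ) / 2 ^ (l + 1) * ((l + 1 : ℕ) + 1) = n / 2 ^ l * ((l + 2) / 2) := by
    rw [pow_succ]; push_cast; field_simp; ring
  rw [h]
  gcongr
  have : (0 : ℝ) ≤ l := by positivity
  linarith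

/-- The empirical split errs by at most 2s/N, where s bounds the deviation of the counts of parent
and left child and N ≥ n m₀/2^(l+1). That is half of 8K/m₀ times √(2^l (l+1)/n), whence the
requirement on D. -/
theorem count_bounds_of_notMem_badSamples (hm₀ : 0 < m₀) (hf : f ∈ densityClass m₀ m₁)
    {n L : ℕ} (hn : 0 < n) {K D τ : ℝ} (hK : 0 ≤ K) (hD : 8 * K / m₀ ≤ D) {l k : ℕ} (hl : l < L)
    (hk : k < 2 ^ l) (hτ : (l : ℝ) + 1 ≤ τ) {X : Fin n → ℝ} (hX : X ∉ badSamples n L f K)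
    (hsmall : K * √(n / 2 ^ l * (l + 1)) ≤ n * (m₀ / 2 ^ l) / 2) :
    n * (m₀ / 2 ^ l) / 2 ≤ count X l k ∧
      |(count X (l + 1) (2 * k) : ℝ) / count X l k - trueSplit f l k|
        ≤ D * √(2 ^ l * τ / n) / 2 := by
  have hn' : (0 : ℝ) < n := by exact_mod_cast hn
  have hk0 : 2 * k < 2 ^ (l + 1) := by rw [pow_succ]; omega
  simp only [badSamples, mem_ofPred_eq, not_exists, not_and, not_lt] at hX
  have h0 := hX l hl.le k hk
  have h1 := (hX (l + 1) hl (2 * k) hk0).trans (deviation_scale_succ_le hK n l)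
  have hM := (dyadicMass_bounds hf hk).1
  have hm₁ : 0 < m₁ := by linarith [(one_le_of_mem_densityClass hf).2]
  obtain ⟨hz0, hz1⟩ := trueSplit_bounds hm₀ hf hk
  have hδ : 0 < m₀ / (2 * m₁) := by positivity
  set s := K * √(n / 2 ^ l * (l + 1)) with hs
  set z := trueSplit f l k with hz
  have hN : n * (m₀ / 2 ^ l) / 2 ≤ count X l k := by
    have h3 := (abs_le.1 h0).1
    have h4 : n * (m₀ / 2 ^ l) ≤ n * dyadicMass f l k := by gcongr
    linarith
  have hNpos : (0 : ℝ) < count X l k := lt_of_lt_of_le (by positivity) hN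
  refine ⟨hN, ?_⟩
  have hdiff : (count X (l + 1) (2 * k) : ℝ) / count X l k - z
      = ((count X (l + 1) (2 * k) - n * dyadicMass f (l + 1) (2 * k))
        - z * (count X l k - n * dyadicMass f l k)) / count X l k := by
    rw [dyadicMass_left hm₀ hf hk]
    field_simp
    ring
  have hs0 : 0 ≤ s := by positivity
  have hnum : |(count X (l + 1) (2 * k) - n * dyadicMass f (l + 1) (2 * k))
        - z * (count X l k - n * dyadicMass f l k)| ≤ 2 * s := by
    refine (abs_sub _ _).trans ?_
    rw [abs_mul, abs_of_nonneg (by linarith : (0 : ℝ) ≤ z), two_mul s]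
    refine add_le_add h1 ?_
    calc z * |count X l k - n * dyadicMass f l k| ≤ 1 * s := by
          gcongr
          linarith
      _ = s := one_mul s
  have hroot : s = n / 2 ^ l * (K * √(2 ^ l * (l + 1) / n)) := by
    have : (n : ℝ) / 2 ^ l * (l + 1) = (n / 2 ^ l) ^ 2 * (2 ^ l * (l + 1) / n) := by
      field_simp
    rw [hs, this, Real.sqrt_mul (by positivity), Real.sqrt_sq (by positivity)]
    ring
  rw [hdiff, abs_div, abs_of_pos hNpos, div_le_iff₀ hNpos]
  calc _ ≤ 2 * s := hnum
    _ = 8 * K / m₀ * √(2 ^ l * (l + 1) / n) / 2 * (n * (m₀ / 2 ^ l) / 2) := by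
        rw [hroot]; field_simp; ring
    _ ≤ D * √(2 ^ l * τ / n) / 2 * count X l k := by
        have h5 : √(2 ^ l * (l + 1) / n) ≤ √(2 ^ l * τ / n) := by gcongr
        have h6 : 0 ≤ 8 * K / m₀ := by positivity
        have h7 : 0 ≤ D := h6.trans hD
        gcongr

/-- Half of the radius r is spent on the distance from the empirical to the true split. The other
half enters the one-node bound, whose exponent N(r/2)²/4 with N ≥ n m₀/2^(l+1) is at least m₀D²τ/32.
-/
theorem exists_setLIntegral_nodeLikelihood_le (a : ℕ+) (hm₀ : 0 < m₀) (hm₁ : 0 < m₁) :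
    ∃ C : ℝ, 0 < C ∧ ∀ (n L : ℕ) (f : ℝ → ℝ) (K D τ p : ℝ) (l k : ℕ) (X : Fin n → ℝ), 0 < n →
      f ∈ densityClass m₀ m₁ → 0 ≤ K → 8 * K / m₀ ≤ D → l < L → k < 2 ^ l → (l : ℝ) + 1 ≤ τ →
      0 < p → p ≤ 1 → (∀ i, X i ∈ Ioc (0 : ℝ) 1) → X ∉ badSamples n L f K →
      K * √(n / 2 ^ l * (l + 1)) ≤ n * (m₀ / 2 ^ l) / 2 →
      D * √(2 ^ l * τ / n) ≤ m₀ / (2 * m₁) →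
      ∫⁻ y in Subtype.val ⁻¹' {y | D * √(2 ^ l * τ / n) < |y - trueSplit f l k|},
          nodeLikelihood X l k y ∂(splitLaw a p)
        ≤ ENNReal.ofReal (C * Real.exp (-(m₀ * D ^ 2 / 32 * τ)) * (1 + (1 - p) / p * √n))
          * ∫⁻ y, nodeLikelihood X l k y ∂(splitLaw a p) := by
  have hδ : 0 < m₀ / (2 * m₁) := by positivity
  obtain ⟨C, hC, h⟩ := exists_setLIntegral_splitLaw_le a (half_pos hδ)
  refine ⟨C, hC, ?_⟩
  intro n L f K D τ p l k X hn hf hK hD hl hk hτ hp hp1 hX hgood hsmall hrad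
  have hn' : (0 : ℝ) < n := by exact_mod_cast hn
  obtain ⟨hN, hdev⟩ := count_bounds_of_notMem_badSamples hm₀ hf hn hK hD hl hk hτ hgood hsmall
  obtain ⟨hz0, hz1⟩ := trueSplit_bounds hm₀ hf hk
  have hcount := count_children (fun i => (hX i).1) l k
  have hτ0 : 0 ≤ τ := le_trans (by positivity) hτ
  set r := D * √(2 ^ l * τ / n) with hr
  have hr0 : 0 ≤ r := by
    have : 0 ≤ 8 * K / m₀ := by positivity
    have := this.trans hD
    positivity
  have hNpos : (0 : ℝ) < count X l k := lt_of_lt_of_le (by positivity) hN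
  have hcast : (count X (l + 1) (2 * k) : ℝ) + count X (l + 1) (2 * k + 1) = count X l k := by
    exact_mod_cast hcount
  obtain ⟨hd1, hd2⟩ := abs_le.1 hdev
  have hB : MeasurableSet {y : ℝ | r < |y - trueSplit f l k|} :=
    measurableSet_lt measurable_const (by fun_prop)
  refine (h (count X (l + 1) (2 * k)) (count X (l + 1) (2 * k + 1)) p
    (count X (l + 1) (2 * k) / count X l k) (r / 2) _ hp hp1 ?_ ?_ ?_ ?_ hB ?_).trans ?_
  · rw [hcount]; exact_mod_cast hNpos
  · linarith
  · linarith
  · rw [hcast, mul_div_cancel₀ _ hNpos.ne']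
  · intro y hy
    rw [sq_le_sq, abs_of_nonneg (by positivity)]
    have h1 : r < |y - trueSplit f l k| := hy
    have h2 := abs_sub_le y ((count X (l + 1) (2 * k) : ℝ) / count X l k) (trueSplit f l k)
    linarith
  · rw [hcast]
    refine mul_le_mul_left (ENNReal.ofReal_le_ofReal ?_) _
    have hsq : r ^ 2 = D ^ 2 * (2 ^ l * τ / n) := by
      rw [hr, mul_pow, Real.sq_sqrt (by positivity)]
    have hexp : m₀ * D ^ 2 / 32 * τ ≤ count X l k * (r / 2) ^ 2 / 4 := by
      calc m₀ * D ^ 2 / 32 * τ = n * (m₀ / 2 ^ l) / 2 * (r / 2) ^ 2 / 4 := by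
            rw [div_pow, hsq]; field_simp; ring
        _ ≤ _ := by gcongr
    have hle : (count X l k : ℝ) ≤ n := by exact_mod_cast count_le X l k
    have hp0 : 0 ≤ 1 - p := by linarith
    gcongr

/-- The squared deviation of the splitting variables at level `l`, up to the factor `2^l/n`. -/
def errorScale (l₀ n l : ℕ) : ℝ := if l ≤ l₀ then (l : ℝ) + 1 else 2 * Real.log n

/-- The set of values of the splitting variable at `(l, k)` that are far from the true split. -/
def farSplits (D : ℝ) (l₀ n : ℕ) (f : ℝ → ℝ) (l k : ℕ) : Set I :=
  Subtype.val ⁻¹' {y | D * √(2 ^ l * errorScale l₀ n l / n) < |y - trueSplit f l k|}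

theorem measurableSet_farSplits (D : ℝ) (l₀ n : ℕ) (f : ℝ → ℝ) (l k : ℕ) :
    MeasurableSet (farSplits D l₀ n f l k) :=
  measurable_subtype_coe (measurableSet_lt measurable_const (by fun_prop))

/-- Up to depth l₀ the slab weight is 1 and the spike costs nothing. Deeper, since l + 1 ≤ 2 log n,
the cost is at most 2n^(2κ+1), while the scale 2 log n gives a gain n^(-2B). Thus B must exceed κ,
whatever the value of κ. -/
theorem slabWeight_factor_le {κ b B : ℝ} (hκ : 0 ≤ κ) (hb : 0 ≤ b) (hB : b + κ + 1 ≤ B)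
    {l₀ n l : ℕ} (hn : 0 < n) (hln : (l : ℝ) + 1 ≤ 2 * Real.log n) :
    Real.exp (-(B * errorScale l₀ n l))
        * (1 + (1 - slabWeight κ l₀ l) / slabWeight κ l₀ l * √n)
      ≤ 2 * Real.exp (-b) ^ (l + 1) := by
  have hn' : (0 : ℝ) < n := by exact_mod_cast hn
  rw [← Real.exp_nat_mul]
  push_cast
  by_cases h : l ≤ l₀
  · simp only [errorScale, slabWeight, if_pos h, sub_self, zero_div, zero_mul, add_zero, mul_one]
    have : Real.exp (-(B * (l + 1))) ≤ Real.exp ((l + 1) * -b) := by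
      rw [Real.exp_le_exp]
      nlinarith [(Nat.cast_nonneg l : (0 : ℝ) ≤ l)]
    linarith [Real.exp_pos ((l + 1 : ℝ) * -b)]
  · simp only [errorScale, slabWeight, if_neg h]
    have hlog : 0 ≤ Real.log n := by
      have : (0 : ℝ) ≤ l := Nat.cast_nonneg l
      linarith
    have hsq : √(n : ℝ) ≤ Real.exp (Real.log n) := by
      rw [Real.exp_log hn']
      have h1 : (1 : ℝ) ≤ n := by exact_mod_cast hn
      exact Real.sqrt_le_iff.2 ⟨hn'.le, by nlinarith⟩
    have hw : (1 - Real.exp (-κ * (l + 1))) / Real.exp (-κ * (l + 1))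
        ≤ Real.exp (2 * κ * Real.log n) := by
      rw [div_le_iff₀ (Real.exp_pos _), ← Real.exp_add]
      have : 1 ≤ Real.exp (2 * κ * Real.log n + -κ * (l + 1)) :=
        Real.one_le_exp (by nlinarith)
      linarith [Real.exp_pos (-κ * (l + 1))]
    have h1 : 1 ≤ Real.exp ((2 * κ + 1) * Real.log n) := Real.one_le_exp (by positivity)
    have h2 : (1 - Real.exp (-κ * (l + 1))) / Real.exp (-κ * (l + 1)) * √n
        ≤ Real.exp ((2 * κ + 1) * Real.log n) := by
      calc _ ≤ Real.exp (2 * κ * Real.log n) * Real.exp (Real.log n) := by gcongr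
        _ = _ := by rw [← Real.exp_add]; congr 1; ring
    calc _ ≤ Real.exp (-(B * (2 * Real.log n))) * (2 * Real.exp ((2 * κ + 1) * Real.log n)) := by
          gcongr; linarith
      _ = 2 * Real.exp (-(B * (2 * Real.log n)) + (2 * κ + 1) * Real.log n) := by
          rw [Real.exp_add]; ring
      _ ≤ _ := by
          gcongr
          nlinarith

/-- The expected posterior mass of the event that some splitting variable is far from the truth. -/
theorem exists_lintegral_posterior_farSplits_le (a : ℕ+) (hm₀ : 0 < m₀) (hm₁ : 0 < m₁) :
    ∃ C : ℝ, 0 < C ∧ ∀ (n l₀ : ℕ) (f : ℝ → ℝ) (κ K D b : ℝ), 0 < n → f ∈ densityClass m₀ m₁ →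
      0 ≤ κ → 0 ≤ K → 8 * K / m₀ ≤ D → 0 ≤ b → b + κ + 1 ≤ m₀ * D ^ 2 / 32 →
      Real.exp (-(K ^ 2 / (4 * m₁))) ≤ 1 / 4 → Real.exp (-b) ≤ 1 / 4 →
      (cutoff n : ℝ) ≤ 2 * Real.log n →
      (∀ l ≤ cutoff n, K * √(n / 2 ^ l * (l + 1)) ≤ n * (m₀ / 2 ^ l) / 2) →
      (∀ l < cutoff n, D * √(2 ^ l * errorScale l₀ n l / n) ≤ m₀ / (2 * m₁)) →
      ∫⁻ X, posteriorLaw a κ l₀ n X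
          {Y | ∃ ν : Node (cutoff n), Y ν ∈ farSplits D l₀ n f ν.1 ν.2} ∂(sampleLaw n f)
        ≤ ENNReal.ofReal (4 * Real.exp (-(K ^ 2 / (4 * m₁))) + C * Real.exp (-b)) := by
  obtain ⟨C, hC, h⟩ := exists_setLIntegral_nodeLikelihood_le a hm₀ hm₁
  refine ⟨4 * C, by positivity, ?_⟩
  intro n l₀ f κ K D b hn hf hκ hK hD hb hbD hq1 hq2 hcut hsmall hrad
  have hprob := isProbabilityMeasure_densityMeasure hm₀.le hf
  have hprob' : IsProbabilityMeasure (sampleLaw n f) := by unfold sampleLaw; infer_instance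
  have hn' : (0 : ℝ) < n := by exact_mod_cast hn
  set q := Real.exp (-b) with hq
  have hq0 : 0 ≤ q := (Real.exp_pos _).le
  have hac := sampleLaw_absolutelyContinuous n hm₀.le hf
  have hpost : ∀ᵐ X ∂(sampleLaw n f), ∀ ν : Node (cutoff n), _ :=
    ae_all_iff.2 fun ν => hac.ae_le
      (posterior_split_le a κ l₀ n ν (measurableSet_farSplits D l₀ n f ν.1 ν.2))
  have hbound : ∀ᵐ X ∂(sampleLaw n f), posteriorLaw a κ l₀ n X
      {Y | ∃ ν : Node (cutoff n), Y ν ∈ farSplits D l₀ n f ν.1 ν.2}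
      ≤ (badSamples n (cutoff n) f K).indicator 1 X
        + ∑ ν : Node (cutoff n), ENNReal.ofReal (2 * C * q ^ ((ν.1 : ℕ) + 1)) := by
    -- On bad samples the posterior mass is bounded by 1, on good ones by a union bound over the
    -- nodes.
    filter_upwards [hpost, hac.ae_le (ae_pi_unitVolume_mem n)] with X hX hmem
    have : IsMarkovKernel (posteriorLaw a κ l₀ n) := by unfold posteriorLaw; infer_instance
    by_cases hbad : X ∈ badSamples n (cutoff n) f K
    · rw [indicator_of_mem hbad]
      exact prob_le_one.trans le_self_add
    · rw [indicator_of_notMem hbad, zero_add, ofPred_exists]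
      refine (measure_iUnion_fintype_le _ _).trans (Finset.sum_le_sum fun ν _ => ?_)
      have hlL : ((ν.1 : ℕ) : ℝ) + 1 ≤ 2 * Real.log n :=
        le_trans (by exact_mod_cast ν.1.2) hcut
      have hw1 : slabWeight κ l₀ ν.1 ≤ 1 := by
        unfold slabWeight
        split_ifs
        · exact le_rfl
        · rw [Real.exp_le_one_iff, neg_mul]
          have : 0 ≤ κ * (((ν.1 : ℕ) : ℝ) + 1) := by positivity
          linarith
      have hτ : ((ν.1 : ℕ) : ℝ) + 1 ≤ errorScale l₀ n ν.1 := by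
        unfold errorScale
        split_ifs
        · exact le_rfl
        · exact hlL
      refine hX ν _ ((h n (cutoff n) f K D (errorScale l₀ n ν.1) (slabWeight κ l₀ ν.1) ν.1 ν.2 X
        hn hf hK hD ν.1.2 ν.2.2 hτ (slabWeight_pos _ _ _) hw1 hmem hbad (hsmall _ ν.1.2.le)
        (hrad _ ν.1.2)).trans (mul_le_mul_left (ENNReal.ofReal_le_ofReal ?_) _))
      rw [mul_assoc, mul_comm 2 C, mul_assoc]
      exact mul_le_mul_of_nonneg_left (slabWeight_factor_le hκ hb hbD hn hlL) hC.le
  have hsum : ∑ ν : Node (cutoff n), ENNReal.ofReal (2 * C * q ^ ((ν.1 : ℕ) + 1))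
      ≤ ENNReal.ofReal (4 * C * q) := by
    rw [← ENNReal.ofReal_sum_of_nonneg fun ν _ => by positivity]
    refine ENNReal.ofReal_le_ofReal ?_
    have hs := sum_two_pow_mul_pow_le hq0 hq2 (cutoff n)
    rw [Fintype.sum_sigma]
    simp only [Finset.sum_const, Finset.card_univ, Fintype.card_fin, nsmul_eq_mul]
    rw [Finset.sum_range] at hs
    calc _ = 2 * C * ∑ l : Fin (cutoff n), (2 : ℝ) ^ (l : ℕ) * q ^ ((l : ℕ) + 1) := by
          rw [Finset.mul_sum]
          refine Finset.sum_congr rfl fun l _ => ?_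
          push_cast; ring
      _ ≤ 2 * C * (2 * q) := by gcongr
      _ = _ := by ring
  have hbadle := sampleLaw_badSamples_le (L := cutoff n) hn hm₀.le hf hK hq1 fun l hl => by
    refine (hsmall l hl).trans ?_
    have h01 : m₀ ≤ m₁ := (one_le_of_mem_densityClass hf).1.trans (one_le_of_mem_densityClass hf).2
    have h1 : n * (m₀ / 2 ^ l) ≤ n * (m₁ / 2 ^ l) := by gcongr
    have h2 : 0 ≤ n * (m₁ / 2 ^ l) := by positivity
    linarith
  refine (lintegral_mono_ae hbound).trans ?_
  rw [lintegral_add_right _ measurable_const, lintegral_const, measure_univ, mul_one,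
    ENNReal.ofReal_add (by positivity) (by positivity)]
  exact add_le_add ((lintegral_indicator_one_le _).trans hbadle) hsum

/-! ### The multiscale norm on the event that all splits are close to the truth -/

theorem errorScale_nonneg (l₀ n l : ℕ) : 0 ≤ errorScale l₀ n l := by
  unfold errorScale
  split_ifs
  · positivity
  · have := Real.log_natCast_nonneg n
    positivity

theorem errorScale_le {l₀ n : ℕ} (hl₀ : (l₀ : ℝ) + 1 ≤ 2 * Real.log n) (l : ℕ) :
    errorScale l₀ n l ≤ 2 * Real.log n := by
  unfold errorScale
  split_ifs with h
  · have : (l : ℝ) ≤ l₀ := by exact_mod_cast h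
    linarith
  · exact le_rfl

/-- Monotonicity across the jump at l₀ ensures that the radii grow at least by √2 from one level to
the next. -/
theorem errorScale_le_succ {l₀ n : ℕ} (hl₀ : (l₀ : ℝ) + 1 ≤ 2 * Real.log n) (l : ℕ) :
    errorScale l₀ n l ≤ errorScale l₀ n (l + 1) := by
  by_cases h : l + 1 ≤ l₀
  · have h' : l ≤ l₀ := by omega
    simp only [errorScale, if_pos h, if_pos h']
    push_cast
    linarith
  · refine (errorScale_le hl₀ l).trans (le_of_eq ?_)
    simp only [errorScale, if_neg h]

/-- Below the cut-off, dividing the error in a split at level l by 2^(l/2) leaves a multiple of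
√(scale/n), controlled by the weight; from the cut-off on, only the bias of f is left. -/
theorem multiscaleNorm_lt_of_forall_notMem_farSplits (hm₀ : 0 < m₀)
    (hf : f ∈ densityClass m₀ m₁) {n l₀ : ℕ} (hn : 0 < n) {D c M : ℝ} (hD : 0 ≤ D) (hc : 0 < c)
    {w : ℕ → ℝ} (hw : ∀ l, 0 < w l) (hM : 0 < M) (hl₀ : (l₀ : ℝ) + 1 ≤ 2 * Real.log n)
    (hrad : ∀ l < cutoff n, D * √(2 ^ l * errorScale l₀ n l / n) ≤ m₀ / (2 * m₁) / 10)
    (hwlow : ∀ l < cutoff n, c * √(errorScale l₀ n l) ≤ w l)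
    (hMD : 12 * m₁ * (D / (m₀ / (2 * m₁))) / c ≤ M)
    (hhigh : ∀ l k, cutoff n ≤ l → k < 2 ^ l → |haarCoeff f l k| ≤ w l * (M / 2 / √n))
    {Y : Splits (cutoff n)} (hY : ∀ ν : Node (cutoff n), Y ν ∉ farSplits D l₀ n f ν.1 ν.2) :
    multiscaleNorm w (fun x => treeDensity (cutoff n) Y x - f x) < ENNReal.ofReal (M / √n) := by
  have hn' : (0 : ℝ) < n := by exact_mod_cast hn
  have hm₁ : 0 < m₁ := by linarith [(one_le_of_mem_densityClass hf).2]
  have hsn : 0 < √(n : ℝ) := Real.sqrt_pos.2 hn'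
  set δ := m₀ / (2 * m₁) with hδdef
  have hδ : 0 < δ := by positivity
  have hlow : ∀ l < cutoff n, ∀ k < 2 ^ l,
      |haarCoeff (fun x => treeDensity (cutoff n) Y x - f x) l k| ≤ w l * (M / 2 / √n) := by
    intro l hl k hk
    -- Scaled so that δ q is the radius defining the far splits.
    set q : ℕ → ℝ := fun l => D / δ * √(2 ^ l * errorScale l₀ n l / n) with hq
    have hδq : ∀ l, δ * q l = D * √(2 ^ l * errorScale l₀ n l / n) := fun l => by
      simp only [hq]; field_simp
    have hbase : |haarCoeff (fun x => treeDensity (cutoff n) Y x - f x) l k|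
        ≤ 6 * m₁ * (q l / √(2 ^ l)) := by
      refine abs_haarCoeff_treeDensity_sub_le hm₀ hf (fun l => by positivity) ?_ ?_ ?_ hl hk
      · intro j hj
        have h1 := hrad j hj
        rw [← hδq] at h1
        have h2 : δ * q j ≤ δ * (1 / 10) := by linarith
        exact le_of_mul_le_mul_left h2 hδ
      · intro j _
        -- The ratio (27/5)/4 = 27/20 is smaller than √2, the growth of the radius per level.
        have h1 : 27 / 20 * √(2 ^ j * errorScale l₀ n j / n)
            ≤ √(2 ^ (j + 1) * errorScale l₀ n (j + 1) / n) := by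
          refine Real.le_sqrt_of_sq_le ?_
          have := errorScale_nonneg l₀ n j
          rw [mul_pow, Real.sq_sqrt (by positivity)]
          calc (27 / 20 : ℝ) ^ 2 * (2 ^ j * errorScale l₀ n j / n)
              ≤ 2 * (2 ^ j * errorScale l₀ n j / n) := by gcongr; norm_num
            _ ≤ 2 * (2 ^ j * errorScale l₀ n (j + 1) / n) := by
                gcongr
                exact errorScale_le_succ hl₀ j
            _ = _ := by rw [pow_succ]; ring
        have h2 : 0 ≤ D / δ := by positivity
        calc 27 / 5 * q j = 4 * (D / δ * (27 / 20 * √(2 ^ j * errorScale l₀ n j / n))) := by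
              simp only [hq]; ring
          _ ≤ 4 * q (j + 1) := by simp only [hq]; gcongr
      · intro j hj i hi
        rw [hδq]
        have h1 := hY ⟨⟨j, hj⟩, ⟨i, hi⟩⟩
        have h2 : splitAt Y j i = Y ⟨⟨j, hj⟩, ⟨i, hi⟩⟩ := by simp [splitAt, hj, hi]
        rw [h2]
        exact not_lt.1 h1
    refine hbase.trans ?_
    have hq' : q l / √(2 ^ l) = D / δ * (√(errorScale l₀ n l) / √n) := by
      have h2 : (0 : ℝ) < √(2 ^ l) := by positivity
      simp only [hq]
      rw [mul_div_assoc (2 ^ l : ℝ), Real.sqrt_mul (by positivity), Real.sqrt_div'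
        _ (by positivity)]
      field_simp
    have hE : √(errorScale l₀ n l) ≤ w l / c := by
      rw [le_div_iff₀ hc, mul_comm]; exact hwlow l hl
    have hw' := hw l
    calc 6 * m₁ * (q l / √(2 ^ l)) = 6 * m₁ * (D / δ) * √(errorScale l₀ n l) / √n := by
          rw [hq']; ring
      _ ≤ 6 * m₁ * (D / δ) * (w l / c) / √n := by gcongr
      _ = w l * (12 * m₁ * (D / δ) / c / 2 / √n) := by field_simp; ring
      _ ≤ _ := by gcongr
  have hall : ∀ l k, k < 2 ^ l →
      |haarCoeff (fun x => treeDensity (cutoff n) Y x - f x) l k| ≤ w l * (M / 2 / √n) := by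
    intro l k hk
    rcases lt_or_ge l (cutoff n) with hl | hl
    · exact hlow l hl k hk
    · rw [haarCoeff_treeDensity_sub_of_le Y hf.1 hl hk, abs_neg]
      exact hhigh l k hl hk
  -- The coefficients are bounded with M/2 because a supremum preserves only weak inequalities, and
  -- a strict one is wanted.
  have hle : multiscaleNorm w (fun x => treeDensity (cutoff n) Y x - f x)
      ≤ ENNReal.ofReal (M / 2 / √n) := by
    refine iSup_le fun l => iSup_le fun k => ENNReal.ofReal_le_ofReal ?_
    rw [div_le_iff₀' (hw l)]
    exact hall l k k.2
  refine hle.trans_lt ((ENNReal.ofReal_lt_ofReal_iff (by positivity)).2 ?_)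
  gcongr
  linarith

/-! ### The cut-off -/

theorem two_pow_cutoff_mul_le (n : ℕ) : 2 ^ cutoff n * cutoff n ^ 2 ≤ n :=
  Nat.findGreatest_spec (P := fun L => 2 ^ L * L ^ 2 ≤ n) (Nat.zero_le n) (by simp)

theorem lt_two_pow_cutoff_succ_mul {n : ℕ} (hn : 0 < n) :
    n < 2 ^ (cutoff n + 1) * (cutoff n + 1) ^ 2 := by
  by_cases h : cutoff n + 1 ≤ n
  · exact not_le.1 (Nat.findGreatest_is_greatest (P := fun L => 2 ^ L * L ^ 2 ≤ n)
      (Nat.lt_succ_self _) h)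
  -- The search defining the cut-off stops at n, so its maximality says nothing in this case.
  · have h1 : n < cutoff n + 1 := by omega
    have h2 : 0 < 2 ^ (cutoff n + 1) := by positivity
    nlinarith

theorem log_le_cutoff {n : ℕ} (hn : 0 < n) : Real.log n ≤ 3 * (cutoff n + 1) := by
  have hn' : (0 : ℝ) < n := by exact_mod_cast hn
  have h : (n : ℝ) ≤ 2 ^ (cutoff n + 1) * ((cutoff n : ℝ) + 1) ^ 2 := by
    exact_mod_cast (lt_two_pow_cutoff_succ_mul hn).le
  have h1 := Real.log_le_log hn' h
  rw [Real.log_mul (by positivity) (by positivity), Real.log_pow, Real.log_pow] at h1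
  push_cast at h1
  have h2 : Real.log 2 ≤ 1 := by linarith [Real.log_two_lt_d9]
  have h3 : Real.log ((cutoff n : ℝ) + 1) ≤ cutoff n + 1 := by
    linarith [Real.log_le_sub_one_of_pos (by positivity : (0 : ℝ) < (cutoff n : ℝ) + 1)]
  nlinarith

theorem cutoff_le_log {n : ℕ} (hn : 0 < n) : (cutoff n : ℝ) ≤ 2 * Real.log n := by
  have hn' : (0 : ℝ) < n := by exact_mod_cast hn
  rcases Nat.eq_zero_or_pos (cutoff n) with h0 | h0
  · rw [h0]
    have := Real.log_natCast_nonneg n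
    push_cast; positivity
  · have h : (2 : ℝ) ^ cutoff n ≤ n := by
      have h1 : 2 ^ cutoff n ≤ n := le_trans (Nat.le_mul_of_pos_right _ (by positivity))
        (two_pow_cutoff_mul_le n)
      exact_mod_cast h1
    have h1 := Real.log_le_log (by positivity) h
    rw [Real.log_pow] at h1
    have h2 : 1 / 2 ≤ Real.log 2 := by linarith [Real.log_two_gt_d9]
    nlinarith [(Nat.cast_nonneg (cutoff n) : (0 : ℝ) ≤ cutoff n)]

theorem tendsto_log_natCast : Tendsto (fun n : ℕ => Real.log n) atTop atTop :=
  Real.tendsto_log_atTop.comp tendsto_natCast_atTop_atTop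

theorem tendsto_cutoff : Tendsto cutoff atTop atTop := by
  rw [← tendsto_natCast_atTop_iff (R := ℝ)]
  have h : Tendsto (fun n : ℕ => Real.log n / 3 - 1) atTop atTop :=
    tendsto_atTop_add_const_right _ _ (tendsto_log_natCast.atTop_div_const (by norm_num))
  refine tendsto_atTop_mono' _ ?_ h
  filter_upwards [eventually_gt_atTop 0] with n hn
  linarith [log_le_cutoff hn]

/-! ### Conditions that hold for large samples -/

theorem eventually_mul_sqrt_le_natCast (A : ℝ) : ∀ᶠ L : ℕ in atTop, A * √((L : ℝ) + 1) ≤ L := by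
  filter_upwards [tendsto_natCast_atTop_atTop.eventually_ge_atTop (2 * A ^ 2 + 1 : ℝ)] with L hL
  refine le_of_abs_le (abs_le_of_sq_le_sq ?_ (by positivity))
  rw [mul_pow, Real.sq_sqrt (by positivity)]
  nlinarith [sq_nonneg A]

/-- The purpose of the factor L² in the cut-off: every interval of the tree expects at least m₀L²
observations, much more than the order L needed against logarithmic scales. -/
theorem sq_cutoff_le_div {n l : ℕ} (hl : l ≤ cutoff n) : (cutoff n : ℝ) ^ 2 ≤ n / 2 ^ l := by
  rw [le_div_iff₀ (by positivity), mul_comm]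
  calc (2 : ℝ) ^ l * (cutoff n : ℝ) ^ 2 ≤ (2 : ℝ) ^ cutoff n * (cutoff n : ℝ) ^ 2 := by
        gcongr
        norm_num
    _ ≤ (n : ℝ) := by exact_mod_cast two_pow_cutoff_mul_le n

theorem eventually_count_deviation_small (K : ℝ) (hm₀ : 0 < m₀) :
    ∀ᶠ n : ℕ in atTop, ∀ l ≤ cutoff n, K * √(n / 2 ^ l * (l + 1)) ≤ n * (m₀ / 2 ^ l) / 2 := by
  filter_upwards [tendsto_cutoff.eventually (eventually_mul_sqrt_le_natCast (2 * |K| / m₀))]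
    with n hn l hl
  have hx := sq_cutoff_le_div hl
  set x : ℝ := n / 2 ^ l with hxdef
  have hx0 : 0 ≤ x := by positivity
  have h1 : (cutoff n : ℝ) ≤ √x := Real.le_sqrt_of_sq_le hx
  have h2 : √((l : ℝ) + 1) ≤ √((cutoff n : ℝ) + 1) := by gcongr
  have h3 : 2 * |K| / m₀ * √((l : ℝ) + 1) ≤ √x := le_trans (by gcongr) (hn.trans h1)
  calc K * √(x * (l + 1)) ≤ |K| * √(x * (l + 1)) := by gcongr; exact le_abs_self K
    _ = m₀ / 2 * √x * (2 * |K| / m₀ * √((l : ℝ) + 1)) := by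
        rw [Real.sqrt_mul hx0]; field_simp
    _ ≤ m₀ / 2 * √x * √x := by gcongr
    _ = m₀ / 2 * x := by rw [mul_assoc, Real.mul_self_sqrt hx0]
    _ = _ := by rw [hxdef]; ring

/-- With n/2^l ≥ L² and log n ≤ 3(L+1), the radius is at most a constant times √(L+1)/L. -/
theorem eventually_splitRadius_small (D : ℝ) {ε : ℝ} (hε : 0 < ε) {l₀ : ℕ → ℕ}
    (hl₀ : ∀ᶠ n : ℕ in atTop, (l₀ n : ℝ) + 1 ≤ 2 * Real.log n) :
    ∀ᶠ n : ℕ in atTop, ∀ l < cutoff n, D * √(2 ^ l * errorScale (l₀ n) n l / n) ≤ ε := by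
  filter_upwards [tendsto_cutoff.eventually (eventually_mul_sqrt_le_natCast (|D| * √6 / ε)), hl₀,
    tendsto_cutoff.eventually_gt_atTop 0, eventually_gt_atTop 0] with n hn hl₀n hL hn0 l hl
  have hn' : (0 : ℝ) < n := by exact_mod_cast hn0
  have hL' : (0 : ℝ) < cutoff n := by exact_mod_cast hL
  have hx := sq_cutoff_le_div hl.le
  have hE : errorScale (l₀ n) n l ≤ 6 * (cutoff n + 1) := by
    linarith [errorScale_le hl₀n l, log_le_cutoff hn0]
  have h1 : √(2 ^ l * errorScale (l₀ n) n l / n) ≤ √6 * √((cutoff n : ℝ) + 1) / cutoff n := by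
    rw [← Real.sqrt_mul (by norm_num)]
    refine Real.sqrt_le_iff.2 ⟨by positivity, ?_⟩
    rw [div_pow, Real.sq_sqrt (by positivity)]
    have h2 : (2 : ℝ) ^ l * errorScale (l₀ n) n l / n = errorScale (l₀ n) n l / (n / 2 ^ l) := by
      field_simp
    rw [h2]
    have := errorScale_nonneg (l₀ n) n l
    gcongr
  calc _ ≤ |D| * (√6 * √((cutoff n : ℝ) + 1) / cutoff n) := by
        gcongr
        exact le_abs_self D
    _ = ε * (|D| * √6 / ε * √((cutoff n : ℝ) + 1)) / cutoff n := by field_simp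
    _ ≤ ε * cutoff n / cutoff n := by gcongr
    _ = ε := by field_simp

/-- Maximality of the cut-off gives √n ≤ √2 · 2^(L/2) (L+1), so √n times a coefficient of level l ≥
L is at most R√2 (L+1) 2^(-αL), which tends to 0, while the weights there stay above c. -/
theorem eventually_haarCoeff_high_le {α R c : ℝ} (hα : 0 < α) (hR : 0 < R) (hc : 0 < c)
    {w : ℕ → ℝ} {l₀ : ℕ → ℕ} (hl₀ : ∀ᶠ n : ℕ in atTop, l₀ n ≤ cutoff n)
    (hw : ∀ᶠ n : ℕ in atTop, ∀ l : ℕ, l₀ n ≤ l → c * √(Real.log n) ≤ w l) :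
    ∀ᶠ n : ℕ in atTop, ∀ f ∈ holderBall α R, ∀ l k, cutoff n ≤ l → k < 2 ^ l →
      |haarCoeff f l k| ≤ w l * (1 / √n) := by
  have hlim : Tendsto (fun L : ℕ => R * √2 * (((L : ℝ) + 1) * ((2 : ℝ) ^ (-α)) ^ L)) atTop
      (nhds 0) := by
    have h1 : (2 : ℝ) ^ (-α) < 1 := Real.rpow_lt_one_of_one_lt_of_neg (by norm_num) (by linarith)
    have h0 : (0 : ℝ) ≤ (2 : ℝ) ^ (-α) := by positivity
    have := ((tendsto_self_mul_const_pow_of_lt_one h0 h1).add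
      (tendsto_pow_atTop_nhds_zero_of_lt_one h0 h1)).const_mul (R * √2)
    simpa [add_mul] using this
  filter_upwards [hl₀, hw, tendsto_cutoff.eventually (hlim.eventually_le_const hc),
    tendsto_log_natCast.eventually_ge_atTop 1, eventually_gt_atTop 0]
    with n hl₀n hwn hsmall hlog hn0 f hf l k hl hk
  have hn' : (0 : ℝ) < n := by exact_mod_cast hn0
  have hsn : 0 < √(n : ℝ) := Real.sqrt_pos.2 hn'
  have hwl : c ≤ w l := by
    refine le_trans ?_ (hwn l (hl₀n.trans hl))
    exact le_mul_of_one_le_right hc.le (Real.one_le_sqrt.2 hlog)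
  have hsqrt : √(n : ℝ) ≤ √2 * √(2 ^ cutoff n) * (cutoff n + 1) := by
    refine Real.sqrt_le_iff.2 ⟨by positivity, ?_⟩
    rw [mul_pow, mul_pow, Real.sq_sqrt (by norm_num), Real.sq_sqrt (by positivity), ← pow_succ']
    exact_mod_cast (lt_two_pow_cutoff_succ_mul hn0).le
  have hpow : (2 : ℝ) ^ (-(l : ℝ) * (α + 1 / 2)) ≤ ((2 : ℝ) ^ (-α)) ^ cutoff n / √(2 ^ cutoff n) := by
    have e1 : ((2 : ℝ) ^ (-α)) ^ cutoff n / √(2 ^ cutoff n)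
        = (2 : ℝ) ^ (-(cutoff n : ℝ) * (α + 1 / 2)) := by
      rw [Real.sqrt_eq_rpow, ← Real.rpow_natCast, ← Real.rpow_natCast, ← Real.rpow_mul (by norm_num),
        ← Real.rpow_mul (by norm_num), ← Real.rpow_sub (by norm_num)]
      congr 1; ring
    rw [e1]
    have : (cutoff n : ℝ) ≤ l := by exact_mod_cast hl
    refine Real.rpow_le_rpow_of_exponent_le (by norm_num) ?_
    nlinarith
  rw [mul_one_div, le_div_iff₀ hsn]
  have hs2 : (0 : ℝ) < √(2 ^ cutoff n) := by positivity
  calc |haarCoeff f l k| * √n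
      ≤ R * (((2 : ℝ) ^ (-α)) ^ cutoff n / √(2 ^ cutoff n))
          * (√2 * √(2 ^ cutoff n) * (cutoff n + 1)) := by
        gcongr
        exact (hf l k hk).trans (by gcongr)
    _ = R * √2 * (((cutoff n : ℝ) + 1) * ((2 : ℝ) ^ (-α)) ^ cutoff n) := by field_simp
    _ ≤ c := hsmall
    _ ≤ w l := hwl

/-! ### Comparison of the weights with the error scale -/

/-- At l = 0 the assumption on √l is void, although the scale there is at least 1 when l ≤ l₀; hence
w 0 enters the constant. For l ≥ 1 one has √(l+1) ≤ √2 √l. -/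
theorem exists_mul_sqrt_errorScale_le {w : ℕ → ℝ} (hw : ∀ l, 0 < w l) {c₁ c₂ : ℝ} (hc₁ : 0 < c₁)
    (hc₂ : 0 < c₂) (h₁ : ∀ l : ℕ, c₁ * √l ≤ w l) :
    ∃ c : ℝ, 0 < c ∧ ∀ n l₀ : ℕ, (∀ l : ℕ, l₀ ≤ l → c₂ * √(Real.log n) ≤ w l) →
      ∀ l, c * √(errorScale l₀ n l) ≤ w l := by
  have hs2 : (0 : ℝ) < √2 := by positivity
  refine ⟨min (w 0) (min (c₁ / √2) (c₂ / √2)), lt_min (hw 0) (lt_min (by positivity)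
    (by positivity)), fun n l₀ h l => ?_⟩
  set c := min (w 0) (min (c₁ / √2) (c₂ / √2))
  have hcw : c ≤ w 0 := min_le_left _ _
  have hcc₁ : c ≤ c₁ / √2 := (min_le_right _ _).trans (min_le_left _ _)
  have hcc₂ : c ≤ c₂ / √2 := (min_le_right _ _).trans (min_le_right _ _)
  unfold errorScale
  split_ifs with hl
  · rcases Nat.eq_zero_or_pos l with rfl | hpos
    · simpa using hcw
    · have h1 : √((l : ℝ) + 1) ≤ √2 * √l := by
        rw [← Real.sqrt_mul (by norm_num)]
        have : (1 : ℝ) ≤ l := by exact_mod_cast hpos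
        exact Real.sqrt_le_sqrt (by linarith)
      calc _ ≤ c₁ / √2 * (√2 * √l) := by gcongr
        _ = c₁ * √l := by field_simp
        _ ≤ _ := h₁ l
  · rw [Real.sqrt_mul (by norm_num)]
    calc _ ≤ c₂ / √2 * (√2 * √(Real.log n)) := by gcongr
      _ = c₂ * √(Real.log n) := by field_simp
      _ ≤ _ := h l (by omega)

theorem exists_exp_neg_le {ε : ℝ} (hε : 0 < ε) : ∃ b : ℝ, 0 < b ∧ Real.exp (-b) ≤ ε := by
  refine ⟨|Real.log ε| + 1, by positivity, ?_⟩
  rw [← Real.le_log_iff_exp_le hε]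
  linarith [neg_abs_le (Real.log ε)]

end SpikeSlabPolyaTree

end

/-! ### Choice of constants and conclusion -/

theorem theorem5 (m₀ m₁ : ℝ) (hm₀ : 0 < m₀) (hm₁ : 0 < m₁) :
    ∃ κ₀ : ℝ, 0 < κ₀ ∧ ∀ κ : ℝ, κ₀ ≤ κ → ∀ (a : ℕ+) (l₀ : ℕ → ℕ),
      Monotone l₀ → Tendsto l₀ atTop atTop →
      Asymptotics.IsLittleO atTop (fun n : ℕ => (l₀ n : ℝ)) (fun n : ℕ => Real.log n) →
      ∀ w : ℕ → ℝ, (∀ l, 0 < w l) →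
      (∃ c : ℝ, 0 < c ∧ ∀ l : ℕ, c * Real.sqrt l ≤ w l) →
      (∃ c : ℝ, 0 < c ∧ ∀ᶠ n : ℕ in atTop, ∀ l : ℕ, l₀ n ≤ l →
        c * Real.sqrt (Real.log n) ≤ w l) →
      ∀ η R α : ℝ, 0 < η → 0 < R → 0 < α → α ≤ 1 →
      ∃ M : ℝ, 0 < M ∧ ∃ n₀ : ℕ, 1 ≤ n₀ ∧ ∀ n : ℕ, n₀ ≤ n →
        (⨆ f₀ ∈ SpikeSlabPolyaTree.holderBall α R ∩ SpikeSlabPolyaTree.densityClass m₀ m₁,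
          ∫⁻ X, SpikeSlabPolyaTree.posteriorDeviation a κ (l₀ n) n w f₀ (M / Real.sqrt n) X
            ∂(SpikeSlabPolyaTree.sampleLaw n f₀)) < ENNReal.ofReal η := by
  -- The value 1 is arbitrary: the cost of the spike is absorbed by taking D large in terms of κ.
  refine ⟨1, one_pos, ?_⟩
  intro κ hκ a l₀ _ _ hlo w hw ⟨c₁, hc₁, hw₁⟩ ⟨c₂, hc₂, hw₂⟩ η R α hη hR hα _
  have hκ0 : 0 ≤ κ := zero_le_one.trans hκ
  obtain ⟨C, hC, hpost⟩ :=
    SpikeSlabPolyaTree.exists_lintegral_posterior_farSplits_le a hm₀ hm₁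
  obtain ⟨c, hc, hwc⟩ := SpikeSlabPolyaTree.exists_mul_sqrt_errorScale_le hw hc₁ hc₂ hw₁
  -- The bad samples and the far splits are each to contribute at most η/4; the bounds by 1/4 are
  -- for the geometric series over the levels.
  obtain ⟨b₁, hb₁, hq₁⟩ := SpikeSlabPolyaTree.exists_exp_neg_le
    (ε := min (1 / 4) (η / 16)) (lt_min (by norm_num) (by positivity))
  obtain ⟨b₂, hb₂, hq₂⟩ := SpikeSlabPolyaTree.exists_exp_neg_le
    (ε := min (1 / 4) (η / (4 * C))) (lt_min (by norm_num) (by positivity))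
  set K : ℝ := √(4 * m₁ * b₁) with hK
  have hKb : K ^ 2 / (4 * m₁) = b₁ := by
    rw [hK, Real.sq_sqrt (by positivity)]; field_simp
  -- The summand 1 gives D ≥ 1, so that D² ≥ D and the second summand bounds D² from below.
  set D : ℝ := 8 * K / m₀ + 32 * (b₂ + κ + 1) / m₀ + 1 with hD
  have hK0 : 0 ≤ K := Real.sqrt_nonneg _
  have h8 : 0 ≤ 8 * K / m₀ := by positivity
  have h32 : 0 ≤ 32 * (b₂ + κ + 1) / m₀ := by positivity
  have hD1 : 1 ≤ D := by linarith
  have hbD : b₂ + κ + 1 ≤ m₀ * D ^ 2 / 32 := by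
    have h1 : 32 * (b₂ + κ + 1) / m₀ ≤ D ^ 2 := by nlinarith
    rw [div_le_iff₀ hm₀] at h1
    linarith
  -- The 2 serves the bias beyond the cut-off, where M/2 ≥ 1 is needed; the other term serves the
  -- levels below it.
  set M : ℝ := max 2 (12 * m₁ * (D / (m₀ / (2 * m₁))) / c) with hM
  have hM2 : 2 ≤ M := le_max_left _ _
  have hl₀ : ∀ᶠ n : ℕ in atTop, (l₀ n : ℝ) ≤ Real.log n / 6 := by
    filter_upwards [hlo.def (c := 1 / 6) (by norm_num)] with n hn
    rw [Real.norm_of_nonneg (by positivity), Real.norm_of_nonneg (Real.log_natCast_nonneg n)] at hn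
    linarith
  have hl₀log : ∀ᶠ n : ℕ in atTop, (l₀ n : ℝ) + 1 ≤ 2 * Real.log n := by
    filter_upwards [hl₀, SpikeSlabPolyaTree.tendsto_log_natCast.eventually_ge_atTop 1] with n h1 h2
    linarith
  -- From log n ≤ 3(L+1) one gets l₀ ≤ (L+1)/2, which is at most L because log n ≥ 6 forces L ≥ 1.
  have hl₀cut : ∀ᶠ n : ℕ in atTop, l₀ n ≤ SpikeSlabPolyaTree.cutoff n := by
    filter_upwards [hl₀, SpikeSlabPolyaTree.tendsto_log_natCast.eventually_ge_atTop 6,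
      eventually_gt_atTop 0] with n h1 h2 hn
    have h3 := SpikeSlabPolyaTree.log_le_cutoff hn
    have h4 : (l₀ n : ℝ) ≤ SpikeSlabPolyaTree.cutoff n := by linarith
    exact_mod_cast h4
  have hε : 0 < m₀ / (2 * m₁) / 10 := by positivity
  obtain ⟨n₀, hn₀⟩ := eventually_atTop.1 ((((((eventually_ge_atTop 1).and hl₀log).and hw₂).and
    (SpikeSlabPolyaTree.eventually_count_deviation_small K hm₀)).and
    (SpikeSlabPolyaTree.eventually_splitRadius_small D hε hl₀log)).and
    (SpikeSlabPolyaTree.eventually_haarCoeff_high_le hα hR hc₂ hl₀cut hw₂))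
  refine ⟨M, by linarith, max n₀ 1, le_max_right _ _, fun n hn => ?_⟩
  obtain ⟨⟨⟨⟨⟨hn1, hlog⟩, hwn⟩, hcount⟩, hrad⟩, hhigh⟩ := hn₀ n ((le_max_left _ _).trans hn)
  refine lt_of_le_of_lt (b := ENNReal.ofReal (η / 2)) (iSup₂_le fun f hf => ?_)
    ((ENNReal.ofReal_lt_ofReal_iff hη).2 (by linarith))
  have hn' : (0 : ℝ) < n := by exact_mod_cast hn1
  have hmain := hpost n (l₀ n) f κ K D b₂ hn1 hf.2 hκ0 hK0 (by linarith) hb₂.le hbD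
    (by rw [hKb]; exact hq₁.trans (min_le_left _ _)) (hq₂.trans (min_le_left _ _))
    (SpikeSlabPolyaTree.cutoff_le_log hn1) hcount fun l hl => (hrad l hl).trans (by linarith)
  -- The deviation event is included in the event of a far split; monotonicity of the measure needs
  -- no measurability of the multiscale norm.
  refine (lintegral_mono fun X => measure_mono fun Y hY => ?_).trans (hmain.trans
    (ENNReal.ofReal_le_ofReal ?_))
  · by_contra hfar
    simp only [mem_ofPred_eq, not_exists] at hfar
    have hY' : ENNReal.ofReal _ ≤ _ := hY
    refine absurd hY' (not_le.2 ?_)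
    refine SpikeSlabPolyaTree.multiscaleNorm_lt_of_forall_notMem_farSplits hm₀ hf.2 hn1
      (by linarith) hc hw (by linarith) hlog hrad (fun l _ => hwc n (l₀ n) hwn l)
      (le_max_right _ _) ?_ hfar
    intro l k hl hk
    refine (hhigh f hf.1 l k hl hk).trans ?_
    have := (hw l).le
    gcongr
    linarith
  · rw [hKb]
    have h1 : Real.exp (-b₁) ≤ η / 16 := hq₁.trans (min_le_right _ _)
    have h2 : C * Real.exp (-b₂) ≤ C * (η / (4 * C)) := by
      gcongr
      exact hq₂.trans (min_le_right _ _)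
    have h3 : C * (η / (4 * C)) = η / 4 := by field_simp
    linarith
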